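/- Let $(E,\mathcal E)$ be a non-empty measurable space with $\mathcal E$ countably generated, and let $Q$ be a bounded positive kernel on $(E,\mathcal E)$: $Q(\cdot,A)$ is $\mathcal E$-measurable and non-negative for each $A\in\mathcal E$, $Q(x,\cdot)$ is a positive measure for each $x\in E$, and $\sup_{x\in E}Q(x,E)<\infty$. Let $\mathcal B$ be the Banach space of bounded measurable functions $f:E\to\mathbb C$ with the supremum norm. Then $Q$ acts on $\mathcal B$ by $Qf(x)=\int f(y)\,Q(x,dy)$. Let $Q^\ell$ be the $\ell$-th iterate of $Q$ and $R_\ell=\{Q^\ell(x,\cdot):x\in E\}$. Write $r(\cdot)$ for the spectral radius. The essential spectral radius $r_e(Q)$ of $Q$ on $\mathcal B$ is the infimum of $r(Q)$ and of all real $\rho\ge0$ for which $\mathcal B=F\oplus H$ with $Q$-invariant subspaces $F,H$ such that $H$ is closed, $r(Q|_H)<\rho$, $\dim F<\infty$ and all eigenvalues of $Q|_F$ have modulus $\ge\rho$. Let $\mathcal M$ be the space of bounded complex measures on $(E,\mathcal E)$ with the total variation norm $\|\cdot\|$, $\mathcal M'$ its topological dual, $\mathcal M_+\subset\mathcal M$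 the cone of finite positive measures, and $\mathcal P$ the set of probability measures on $(E,\mathcal E)$. A set $K\subset\mathcal M$ is weakly sequentially compact if every sequence in $K$ has a subsequence $(\mu_{n_k})$ for which there is $\mu\in\mathcal M$ with $\phi(\mu_{n_k})\to\phi(\mu)$ for all $\phi\in\mathcal M'$. Let $\mathcal C_{ws}$ be the collection of all weakly sequentially compact subsets of $\mathcal M_+$. For $M\subset\mathcal M_+$ and $\nu\in\mathcal P$ put $$\Gamma(M)=\inf_{K\in\mathcal C_{ws}}\ \sup_{\mu\in M}\ \inf_{\kappa\in K}\|\mu-\kappa\|,\qquad \Delta_\nu(M)=\limsup_{A\in\mathcal E,\ \nu(A)\to0}\ \sup_{\mu\in M}\mu(A),\qquad \Delta(M)=\inf_{\nu\in\mathcal P}\Delta_\nu(M),$$ where sets $A$ with $\nu(A)=0$ are allowed in the upper limit, i.e. $\Delta_\nu(M)=\inf_{\eta>0}\sup\{\mu(A):\mu\in M,\ A\in\mathcal E,\ \nu(A)\le\eta\}$, and an infimum over the empty set is $+\infty$. Put also $$\Lambda(M)=\sup\Big\{\limsup_{n}\ \sup_{\mu\in M}\mu(A_n)\ :\ A_n\in\mathcal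 E,\ A_n\downarrow\emptyset\Big\},\qquad \bar\Lambda(Q)=\inf_{\ell\ge1}\Lambda(R_\ell)^{1/\ell}.$$ Then $$r_e(Q)=\inf_{\ell\ge1}\Delta(R_\ell)^{1/\ell}=\inf_{\ell\ge1}\Gamma(R_\ell)^{1/\ell}\ \ge\ \bar\Lambda(Q).$$ Suppose moreover that there are $\nu\in\mathcal P$, an integer $\ell_0\ge1$ and measurable functions $q_\ell:E\times E\to[0,+\infty]$, $\ell\ge\ell_0$, such that $Q^\ell(x,A)=\int_A q_\ell(x,y)\,d\nu(y)$ for all $\ell\ge\ell_0$, $x\in E$ and $A\in\mathcal E$. Then $$r_e(Q)=\inf_{\ell\ge1}\Delta_\nu(R_\ell)^{1/\ell}=\bar\Lambda(Q)=\inf_{\ell\ge\ell_0}\ \lim_{k\to+\infty}\ \sup_{x\in E}\Big(\int_{\{y:\,q_\ell(x,y)\ge k\}}q_\ell(x,y)\,d\nu(y)\Big)^{1/\ell},$$ where, for every $\ell\ge\ell_0$, the limit as $k\to+\infty$ exists. -/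

import Mathlib

open MeasureTheory ProbabilityTheory Filter Topology
open scoped ENNReal NNReal

noncomputable section

namespace QuasiCompact

section Operators

variable {X : Type*} [NormedAddCommGroup X] [NormedSpace ℂ X]

/-- `X = F ⊕ H` with `F`, `H` invariant under `T`, `H` closed, the spectral radius of `T` on `H`
smaller than `ρ`, `F` finite dimensional, and all eigenvalues of `T` on `F` of modulus `≥ ρ`. -/
def HasSplitting (T : X →L[ℂ] X) (ρ : ℝ≥0) : Prop :=
  ∃ (F H : Submodule ℂ X) (hF : ∀ v ∈ F, T v ∈ F) (hH : ∀ v ∈ H, T v ∈ H),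
    IsCompl F H ∧ IsClosed (H : Set X) ∧
    spectralRadius ℂ (T.restrict hH : H →L[ℂ] H) < ρ ∧
    FiniteDimensional ℂ F ∧
    ∀ z : ℂ, Module.End.HasEigenvalue ((T : X →ₗ[ℂ] X).restrict hF) z → ρ ≤ ‖z‖₊

/-- The essential spectral radius: the infimum of the spectral radius of `T` and of all `ρ ≥ 0`
for which `T` admits a splitting. -/
def essSpectralRadius (T : X →L[ℂ] X) : ℝ≥0∞ :=
  spectralRadius ℂ T ⊓ ⨅ (ρ : ℝ≥0) (_ : HasSplitting T ρ), (ρ : ℝ≥0∞)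

end Operators

section Functions

/-- Bounded measurable complex valued functions on `E` with the supremum norm, as a subspace of
the space `ℓ^∞(E)` of all bounded functions. -/
def bddMeas (E : Type*) [MeasurableSpace E] : Submodule ℂ (lp (fun _ : E => ℂ) ∞) where
  carrier := {f | Measurable (f : E → ℂ)}
  add_mem' := by
    intro f g hf hg
    exact Measurable.add hf hg
  zero_mem' := by
    exact (measurable_zero : Measurable (0 : E → ℂ))
  smul_mem' := by
    intro c f hf
    exact Measurable.const_smul (show Measurable (f : E → ℂ) from hf) c

variable {E : Type*} [MeasurableSpace E]

lemma bddMeas_norm_le (f : bddMeas E) (x : E) : ‖f.1 x‖ ≤ ‖f‖ :=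
  lp.norm_apply_le_norm ENNReal.top_ne_zero f.1 x

lemma bddMeas_integrable (f : bddMeas E) (μ : Measure E) [IsFiniteMeasure μ] :
    Integrable (fun y => f.1 y) μ :=
  Integrable.of_bound (Measurable.aestronglyMeasurable f.2) ‖f‖
    (Eventually.of_forall (bddMeas_norm_le f))

lemma norm_integral_kernel_le (Q : Kernel E E) [IsFiniteKernel Q] (f : bddMeas E) (x : E) :
    ‖∫ y, f.1 y ∂(Q x)‖ ≤ (Q.bound).toReal * ‖f‖ := by
  have h := norm_integral_le_of_norm_le_const (μ := Q x)
    (Eventually.of_forall (bddMeas_norm_le f))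
  refine h.trans ?_
  rw [mul_comm]
  refine mul_le_mul_of_nonneg_right ?_ (norm_nonneg f)
  exact ENNReal.toReal_mono (Kernel.bound_ne_top Q) (Kernel.measure_le_bound Q x Set.univ)

/-- The function `Q f : x ↦ ∫ f(y) Q(x, dy)`. -/
def kernelFun (Q : Kernel E E) [IsFiniteKernel Q] (f : bddMeas E) : bddMeas E :=
  ⟨⟨fun x => ∫ y, f.1 y ∂(Q x), memℓp_infty ⟨(Q.bound).toReal * ‖f‖, by
      rintro _ ⟨x, rfl⟩
      exact norm_integral_kernel_le Q f x⟩⟩,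
    (StronglyMeasurable.integral_kernel (κ := Q) (Measurable.stronglyMeasurable f.2)).measurable⟩

/-- The bounded operator on `bddMeas E` associated with a bounded positive kernel. -/
def kernelOp (Q : Kernel E E) [IsFiniteKernel Q] : bddMeas E →L[ℂ] bddMeas E :=
  LinearMap.mkContinuous
    { toFun := kernelFun Q
      map_add' := by
        intro f g
        ext x
        exact integral_add (bddMeas_integrable f (Q x)) (bddMeas_integrable g (Q x))
      map_smul' := by
        intro c f
        ext x
        exact integral_const_mul c (fun y => f.1 y) }
    (Q.bound).toReal
    (by
      intro f
      exact lp.norm_le_of_forall_le (by positivity) (norm_integral_kernel_le Q f))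

lemma kernelOp_apply (Q : Kernel E E) [IsFiniteKernel Q] (f : bddMeas E) (x : E) :
    (kernelOp Q f).1 x = ∫ y, f.1 y ∂(Q x) := rfl

instance isFiniteKernel_pow (Q : Kernel E E) [IsFiniteKernel Q] (n : ℕ) :
    IsFiniteKernel (Q ^ n) := by
  induction n with
  | zero => rw [pow_zero]; exact inferInstanceAs (IsFiniteKernel Kernel.id)
  | succ k ih => rw [pow_succ]; exact inferInstanceAs (IsFiniteKernel ((Q ^ k) ∘ₖ Q))

/-- The set `{Q(x, ·) : x ∈ E}` of finite positive measures. -/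
def rows (Q : Kernel E E) [IsFiniteKernel Q] : Set (FiniteMeasure E) :=
  Set.range fun x => (⟨Q x, inferInstance⟩ : FiniteMeasure E)

end Functions

section Measures

variable {E : Type*} [MeasurableSpace E]

/-- The total variation norm `v(μ)(E)` of a bounded complex measure. -/
def tvNorm (μ : ComplexMeasure E) : ℝ≥0∞ := μ.variation Set.univ

/-- A positive finite measure, viewed as a complex measure. -/
def toComplex (μ : FiniteMeasure E) : ComplexMeasure E :=
  SignedMeasure.toComplexMeasure (μ : Measure E).toSignedMeasure 0

/-- Linear forms on the space of complex measures that are bounded for the total variation norm,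
that is, the elements of its topological dual. -/
def IsBoundedForm (φ : ComplexMeasure E →ₗ[ℂ] ℂ) : Prop :=
  ∃ C : ℝ≥0, ∀ μ : ComplexMeasure E, ‖φ μ‖ₑ ≤ C * tvNorm μ

/-- Weak sequential compactness: every sequence in `M` has a subsequence that converges weakly to
some complex measure (which need not lie in `M`). -/
def IsWeaklySeqCompact (M : Set (ComplexMeasure E)) : Prop :=
  ∀ u : ℕ → ComplexMeasure E, (∀ n, u n ∈ M) →
    ∃ (μ : ComplexMeasure E) (k : ℕ → ℕ), StrictMono k ∧
      ∀ φ : ComplexMeasure E →ₗ[ℂ] ℂ, IsBoundedForm φ →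
        Tendsto (fun n => φ (u (k n))) atTop (𝓝 (φ μ))

/-- The distance `inf_{ν ∈ K} ‖μ - ν‖` (it is `∞` when `K` is empty). -/
def distTo (μ : FiniteMeasure E) (K : Set (FiniteMeasure E)) : ℝ≥0∞ :=
  ⨅ ν ∈ K, tvNorm (toComplex μ - toComplex ν)

/-- `Γ(M)`: the infimum, over the weakly sequentially compact sets `K` of positive measures, of
`sup_{μ ∈ M} d(μ, K)`. -/
def Gam (M : Set (FiniteMeasure E)) : ℝ≥0∞ :=
  ⨅ (K : Set (FiniteMeasure E)) (_ : IsWeaklySeqCompact (toComplex '' K)), ⨆ μ ∈ M, distTo μ K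

/-- `Δ_ν(M)`: the upper limit of `sup_{μ ∈ M} μ(A)` as `ν(A) → 0`, `A` measurable. -/
def DeltaAt (ν : Measure E) (M : Set (FiniteMeasure E)) : ℝ≥0∞ :=
  limsup (fun A : {A : Set E // MeasurableSet A} => ⨆ μ ∈ M, (μ : Measure E) A.1)
    (comap (fun A : {A : Set E // MeasurableSet A} => ν A.1) (𝓝 0))

/-- `Δ(M)`: the infimum of `Δ_ν(M)` over all probability measures `ν`. -/
def Delta (M : Set (FiniteMeasure E)) : ℝ≥0∞ :=
  ⨅ (ν : Measure E) (_ : IsProbabilityMeasure ν), DeltaAt ν M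

/-- `Λ(M)`: the supremum of `limsup_n sup_{μ ∈ M} μ(A_n)` over all sequences of measurable sets
decreasing to the empty set. -/
def Lam (M : Set (FiniteMeasure E)) : ℝ≥0∞ :=
  ⨆ (A : ℕ → Set E) (_ : ∀ n, MeasurableSet (A n)) (_ : Antitone A) (_ : ⋂ n, A n = ∅),
    limsup (fun n => ⨆ μ ∈ M, (μ : Measure E) (A n)) atTop

/-- `Λ̄(Q) = inf_{ℓ ≥ 1} Λ({Q^ℓ(x, ·) : x ∈ E})^{1/ℓ}`. -/
def LamBar (Q : Kernel E E) [IsFiniteKernel Q] : ℝ≥0∞ :=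
  ⨅ (l : ℕ) (_ : 1 ≤ l), Lam (rows (Q ^ l)) ^ (1 / (l : ℝ))

end Measures

end QuasiCompact

end

/-! The link between operator and measures is `CoverBound`, a quantitative form of
quasi-compactness.

Upper bound for r_e. If Δ_ν(R_ℓ) < ρ^ℓ, truncating the ν-density of Q^ℓ(x,·) at a high level gives
Q^ℓ = A + B, where A has a bounded density and ‖B‖ < ρ^ℓ. A need not be compact, but every A B^i A
is (`isCompactOperator_kernelOp_comp`). In (A + B)^n the words with two or more letters A are
therefore compact, and the rest have total norm below ρ^(ℓn) for some n
(`exists_coverBound_add_pow`). By `hasSplitting_of_coverBound`, an operator with such a power splits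
at ρ: a Riesz argument shows that adjoining generalized eigenvectors for eigenvalues of modulus ≥ ρ
stops at a finite-dimensional F; modulo F the spectral radius is below ρ; a Sylvester equation
provides the invariant complement.

Lower bound. If r_e(Q) < a, the powers of Q are geometrically close to a fixed finite-dimensional
space, where finitely many point evaluations control the norm. Tested on indicators, this bounds all
rows of some Q^ℓ by finitely many of them, up to a^ℓ (`exists_row_control`). Any ν dominating these
rows has Δ_ν(R_ℓ) ≤ a^ℓ.

Γ = Δ on sets of bounded mass (`gam_eq_delta`): measures with density at most k form a weakly
sequentially compact set, by weak compactness in L²; conversely a weakly sequentially compact K has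
Λ(K) = 0, which forces Δ_ν(K) = 0 for some ν.

Λ ≤ Δ_ν by continuity from above. Under absolute continuity Borel–Cantelli gives Δ_ν ≤ Λ, and
submultiplicativity of Λ (`lam_rows_comp_le`) reduces all ℓ to multiples of ℓ₀. -/

namespace QuasiCompact

/-! ### Covering bounds and spectral radii -/

section Operators

variable {X : Type*} [NormedAddCommGroup X] [NormedSpace ℂ X]

/-- The image of the closed unit ball under `S` is covered by finitely many balls of radius `β`. -/
def CoverBound (S : X →L[ℂ] X) (β : ℝ) : Prop :=
  ∃ t : Set X, t.Finite ∧ ∀ x, ‖x‖ ≤ 1 → ∃ y ∈ t, ‖S x - y‖ ≤ β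

lemma CoverBound.nonneg {S : X →L[ℂ] X} {β : ℝ} (h : CoverBound S β) : 0 ≤ β := by
  obtain ⟨t, -, ht⟩ := h
  obtain ⟨y, -, hy⟩ := ht 0 (by simp)
  exact (norm_nonneg _).trans hy

lemma CoverBound.mono {S : X →L[ℂ] X} {β γ : ℝ} (h : CoverBound S β) (hβ : β ≤ γ) :
    CoverBound S γ := by
  obtain ⟨t, ht, h⟩ := h
  refine ⟨t, ht, fun x hx => ?_⟩
  obtain ⟨y, hy, hxy⟩ := h x hx
  exact ⟨y, hy, hxy.trans hβ⟩

/-- A ball of radius α is a translate of α times the unit ball, so its image is covered by scaled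
translates of the cover for S. Covering radii thus multiply like norms. -/
lemma CoverBound.comp {S A : X →L[ℂ] X} {α β : ℝ} (hS : CoverBound S β) (hA : CoverBound A α) :
    CoverBound (S * A) (α * β) := by
  have hα := hA.nonneg
  obtain ⟨t, ht, h⟩ := hS
  obtain ⟨t', ht', h'⟩ := hA
  refine ⟨Set.image2 (fun y z => S y + (α : ℂ) • z) t' t, ht'.image2 _ ht, fun x hx => ?_⟩
  obtain ⟨y, hy, hxy⟩ := h' x hx
  rcases hα.eq_or_lt with h0 | h0
  · obtain ⟨z, hz, -⟩ := h 0 (by simp)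
    refine ⟨_, ⟨y, hy, z, hz, rfl⟩, ?_⟩
    subst h0
    have : A x = y := by simpa [sub_eq_zero] using hxy
    simp [this]
  · have hw : ‖((α : ℂ)⁻¹) • (A x - y)‖ ≤ 1 := by
      rw [norm_smul, norm_inv, Complex.norm_real, Real.norm_of_nonneg hα]
      exact (inv_mul_le_one₀ h0).2 hxy
    obtain ⟨z, hz, hzw⟩ := h _ hw
    refine ⟨_, ⟨y, hy, z, hz, rfl⟩, ?_⟩
    have hne : (α : ℂ) ≠ 0 := by exact_mod_cast h0.ne'
    have : (S * A) x - (S y + (α : ℂ) • z) =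
        (α : ℂ) • (S ((α : ℂ)⁻¹ • (A x - y)) - z) := by
      rw [map_smul, smul_sub, smul_smul, mul_inv_cancel₀ hne, one_smul, map_sub]
      simp only [mul_apply_eq_comp]
      abel
    dsimp only
    rw [this, norm_smul, Complex.norm_real, Real.norm_of_nonneg hα]
    gcongr

lemma coverBound_norm (A : X →L[ℂ] X) : CoverBound A ‖A‖ :=
  ⟨{0}, Set.finite_singleton _, fun x hx => ⟨0, rfl, by
    simpa using (A.le_opNorm x).trans (mul_le_of_le_one_right (norm_nonneg _) hx)⟩⟩

lemma CoverBound.pow {S : X →L[ℂ] X} {β : ℝ} (hS : CoverBound S β) (n : ℕ) :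
    CoverBound (S ^ n) (β ^ n) := by
  induction n with
  | zero =>
    refine (coverBound_norm _).mono ?_
    rw [pow_zero, pow_zero]
    exact ContinuousLinearMap.norm_id_le
  | succ k ih => rw [pow_succ, pow_succ, mul_comm (β ^ k)]; exact ih.comp hS

/-- Outside the spectrum the operator is bounded below up to small perturbations: a spectral point
which is a limit of points of the resolvent set is an approximate eigenvalue. -/
lemma exists_approx_eigenvector [CompleteSpace X] (A : X →L[ℂ] X) {z : ℂ}
    (hz : z ∈ spectrum ℂ A) (hcl : z ∈ closure (resolventSet ℂ A)) {ε : ℝ} (hε : 0 < ε) :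
    ∃ x : X, ‖x‖ = 1 ∧ ‖A x - z • x‖ ≤ ε := by
  by_contra! hcon
  have hlow : ∀ x : X, ε * ‖x‖ ≤ ‖A x - z • x‖ := by
    intro x
    rcases eq_or_ne x 0 with rfl | hx
    · simp
    · have hx' : ‖x‖ ≠ 0 := norm_ne_zero_iff.2 hx
      have h1 := hcon (((‖x‖⁻¹ : ℝ) : ℂ) • x) (by
        rw [norm_smul, Complex.norm_real, norm_inv, norm_norm, inv_mul_cancel₀ hx'])
      rw [map_smul, smul_comm z, ← smul_sub, norm_smul, Complex.norm_real, norm_inv,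
        norm_norm] at h1
      have := (mul_lt_mul_of_pos_right h1 (norm_pos_iff.2 hx)).le
      rwa [mul_right_comm, inv_mul_cancel₀ hx', one_mul] at this
  obtain ⟨w, hw, hwz⟩ := Metric.mem_closure_iff.1 hcl (ε / 2) (by positivity)
  have hu : IsUnit (algebraMap ℂ (X →L[ℂ] X) w - A) := hw
  obtain ⟨u, hu⟩ := hu
  -- The lower bound at z persists at the resolvent point w with half the constant and bounds the
  -- resolvent there by 2/ε; a Neumann series then reaches z.
  have hR : ‖(↑u⁻¹ : X →L[ℂ] X)‖ ≤ 2 / ε := by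
    refine ContinuousLinearMap.opNorm_le_bound _ (by positivity) fun y => ?_
    set x := (↑u⁻¹ : X →L[ℂ] X) y with hx
    have hy : y = w • x - A x := by
      have h1 : (↑u : X →L[ℂ] X) x = y := by
        rw [hx, ← mul_apply_eq_comp, Units.mul_inv, one_apply_eq_self]
      rw [← h1, hu]
      simp [Algebra.algebraMap_eq_smul_one]
    have h2 : ‖A x - z • x‖ ≤ ‖y‖ + ε / 2 * ‖x‖ := by
      have : A x - z • x = -y + (w - z) • x := by rw [hy, sub_smul]; abel
      rw [this]
      refine (norm_add_le _ _).trans ?_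
      rw [norm_neg, norm_smul]
      gcongr
      rw [← dist_eq_norm, dist_comm]; exact hwz.le
    have h3 := hlow x
    rw [div_mul_eq_mul_div, le_div_iff₀ hε]
    nlinarith
  apply spectrum.notMem_iff.2 _ hz
  have hlt : ‖(w - z) • (↑u⁻¹ : X →L[ℂ] X)‖ < 1 := by
    rw [norm_smul, ← dist_eq_norm, dist_comm]
    calc dist z w * ‖(↑u⁻¹ : X →L[ℂ] X)‖ ≤ dist z w * (2 / ε) := by gcongr
      _ < ε / 2 * (2 / ε) := by gcongr
      _ = 1 := by field_simp
  have : algebraMap ℂ (X →L[ℂ] X) z - A = ↑u * (1 - (w - z) • (↑u⁻¹ : X →L[ℂ] X)) := by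
    rw [mul_sub, mul_one, mul_smul_comm, Units.mul_inv, hu, sub_smul,
      ← Algebra.algebraMap_eq_smul_one, ← Algebra.algebraMap_eq_smul_one]
    abel
  rw [this]
  exact u.isUnit.mul (isUnit_one_sub_of_norm_lt_one hlt)

lemma norm_pow_apply_sub_tendsto (A : X →L[ℂ] X) {z : ℂ} {x : ℕ → X}
    (h : Tendsto (fun n => A (x n) - z • x n) atTop (𝓝 0)) (k : ℕ) :
    Tendsto (fun n => (A ^ k) (x n) - z ^ k • x n) atTop (𝓝 0) := by
  induction k with
  | zero => simp
  | succ k ih =>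
    have h1 := ((A ^ k).continuous.tendsto 0).comp h
    have h2 := (ih.const_smul z).add h1
    simp only [map_zero, smul_zero, add_zero] at h2
    refine h2.congr fun n => ?_
    simp only [Function.comp_apply, map_sub, map_smul, smul_sub, pow_succ, smul_smul,
      mul_apply_eq_comp]
    rw [mul_comm (z ^ k)]
    abel

/-- If some power of `A` is a small perturbation of a compact operator in the sense of coverings,
and `A` has no eigenvalue of modulus `≥ σ`, then its spectral radius is less than `σ`. -/
lemma spectralRadius_lt_of_coverBound [CompleteSpace X] (A : X →L[ℂ] X) {σ : ℝ≥0} (hσ : 0 < σ)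
    {m : ℕ} {β : ℝ} (hc : CoverBound (A ^ m) β) (hβ : β < (σ : ℝ) ^ m)
    (hev : ∀ (z : ℂ) (x : X), σ ≤ ‖z‖₊ → A x = z • x → x = 0) :
    spectralRadius ℂ A < σ := by
  by_contra! hcon
  have hne : (spectrum ℂ A).Nonempty := by
    by_contra hem
    rw [Set.not_nonempty_iff_eq_empty] at hem
    have : spectralRadius ℂ A = 0 := by simp [spectralRadius, hem]
    rw [this] at hcon
    exact hσ.ne' (by simpa using hcon)
  obtain ⟨z, hz, hzr⟩ := spectrum.exists_nnnorm_eq_spectralRadius_of_nonempty hne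
  have hσz : σ ≤ ‖z‖₊ := by rw [← hzr] at hcon; exact_mod_cast hcon
  have hzpos : 0 < ‖z‖ := lt_of_lt_of_le (by exact_mod_cast hσ) (show (σ : ℝ) ≤ ‖z‖ from hσz)
  -- z has maximal modulus in the spectrum, so points slightly further out are resolvent points.
  have hcl : z ∈ closure (resolventSet ℂ A) := by
    have ht : Tendsto (fun n : ℕ => (1 + 1 / ((n : ℂ) + 1)) * z) atTop (𝓝 ((1 + 0) * z)) :=
      (tendsto_one_div_add_atTop_nhds_zero_nat.const_add 1).mul_const z
    rw [add_zero, one_mul] at ht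
    refine mem_closure_of_tendsto ht (Eventually.of_forall fun n => ?_)
    apply spectrum.mem_resolventSet_of_spectralRadius_lt
    rw [← hzr, ENNReal.coe_lt_coe, ← NNReal.coe_lt_coe, coe_nnnorm, coe_nnnorm, norm_mul]
    have : (1 : ℂ) + 1 / ((n : ℂ) + 1) = ((1 + 1 / ((n : ℝ) + 1) : ℝ) : ℂ) := by push_cast; rfl
    rw [this, Complex.norm_real, Real.norm_of_nonneg (by positivity)]
    refine lt_mul_of_one_lt_left hzpos ?_
    have : (0 : ℝ) < 1 / ((n : ℝ) + 1) := by positivity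
    linarith
  choose x hx1 hx2 using fun n : ℕ =>
    exists_approx_eigenvector A hz hcl (show (0 : ℝ) < 1 / ((n : ℝ) + 1) by positivity)
  have hx0 : Tendsto (fun n => A (x n) - z • x n) atTop (𝓝 0) :=
    squeeze_zero_norm hx2 tendsto_one_div_add_atTop_nhds_zero_nat
  -- A^(mj) x n is close to z^(mj) x n, so a finite cover for A^(mj), divided by z^(mj), covers all
  -- but finitely many x n with radius about (β/‖z‖^m)^j.
  have htb : TotallyBounded (Set.range x) := by
    rw [Metric.totallyBounded_iff]
    intro δ hδ
    have hβ0 := hc.nonneg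
    have hβz : β / ‖z‖ ^ m < 1 := by
      rw [div_lt_one (by positivity)]
      exact hβ.trans_le (pow_le_pow_left₀ σ.2 hσz m)
    obtain ⟨j, hj⟩ := exists_pow_lt_of_lt_one (half_pos hδ) hβz
    rw [div_pow, ← pow_mul] at hj
    obtain ⟨t, ht, hcov⟩ := hc.pow j
    rw [← pow_mul] at hcov
    have hzk : 0 < ‖z‖ ^ (m * j) := by positivity
    have hlim := norm_pow_apply_sub_tendsto A hx0 (m * j)
    have hev' := (tendsto_zero_iff_norm_tendsto_zero.1 hlim).eventually
      (gt_mem_nhds (show (0 : ℝ) < δ / 2 * ‖z‖ ^ (m * j) by positivity))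
    obtain ⟨N, hN⟩ := eventually_atTop.1 hev'
    refine ⟨(fun y => (z ^ (m * j))⁻¹ • y) '' t ∪ x '' Set.Iio N,
      (ht.image _).union ((Set.finite_Iio N).image _), ?_⟩
    rintro _ ⟨n, rfl⟩
    rw [Set.mem_iUnion₂]
    by_cases hn : N ≤ n
    · obtain ⟨y, hy, hxy⟩ := hcov (x n) (hx1 n).le
      refine ⟨_, Or.inl ⟨y, hy, rfl⟩, ?_⟩
      have hznz : z ^ (m * j) ≠ 0 := pow_ne_zero _ (norm_pos_iff.1 hzpos)
      have e : x n - (z ^ (m * j))⁻¹ • y = (z ^ (m * j))⁻¹ •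
          (((A ^ (m * j)) (x n) - y) - ((A ^ (m * j)) (x n) - z ^ (m * j) • x n)) := by
        rw [sub_sub_sub_cancel_left, smul_sub, smul_smul, inv_mul_cancel₀ hznz, one_smul]
      rw [Metric.mem_ball, dist_eq_norm]
      dsimp only
      rw [e, norm_smul, norm_inv, norm_pow, inv_mul_lt_iff₀ hzk]
      rw [div_lt_iff₀ hzk] at hj
      have := hN n hn
      calc _ ≤ _ := norm_sub_le _ _
        _ < δ / 2 * ‖z‖ ^ (m * j) + δ / 2 * ‖z‖ ^ (m * j) :=
          add_lt_add_of_le_of_lt (hxy.trans hj.le) this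
        _ = _ := by ring
    · exact ⟨x n, Or.inr ⟨n, not_le.1 hn, rfl⟩, Metric.mem_ball_self hδ⟩
  have hK : IsCompact (closure (Set.range x)) :=
    htb.closure.isCompact_of_isClosed isClosed_closure
  obtain ⟨y, -, φ, hφ, hy⟩ := hK.tendsto_subseq (fun n => subset_closure ⟨n, rfl⟩ :
    ∀ n, x n ∈ closure (Set.range x))
  have hy1 : ‖y‖ = 1 := tendsto_nhds_unique hy.norm (by simp [hx1])
  have hAy : A y - z • y = 0 :=
    tendsto_nhds_unique (((A.continuous.tendsto y).comp hy).sub (hy.const_smul z))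
      (hx0.comp hφ.tendsto_atTop)
  have := hev z y hσz (sub_eq_zero.1 hAy)
  rw [this, norm_zero] at hy1
  exact zero_ne_one hy1

lemma exists_norm_pow_le_of_spectralRadius_lt [CompleteSpace X] (A : X →L[ℂ] X) {σ : ℝ≥0}
    (h : spectralRadius ℂ A < σ) :
    ∃ s : ℝ≥0, s < σ ∧ ∃ C : ℝ, ∀ n : ℕ, ‖A ^ n‖ ≤ C * (s : ℝ) ^ n := by
  obtain ⟨s, hs1, hs2⟩ := ENNReal.lt_iff_exists_nnreal_btwn.1 h
  have hs : s < σ := by exact_mod_cast hs2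
  have hs0 : (0 : ℝ) < s := by
    have : (0 : ℝ≥0∞) < s := (zero_le).trans_lt hs1
    exact_mod_cast this
  refine ⟨s, hs, ?_⟩
  have hev := (spectrum.pow_nnnorm_pow_one_div_tendsto_nhds_spectralRadius A).eventually
    (gt_mem_nhds hs1)
  obtain ⟨N, hN⟩ := eventually_atTop.1 hev
  -- The sum absorbs the finitely many exponents for which Gelfand's formula gives no bound.
  refine ⟨1 + ∑ n ∈ Finset.range (N + 1), ‖A ^ n‖ / (s : ℝ) ^ n, fun n => ?_⟩
  have hsn : (0 : ℝ) < (s : ℝ) ^ n := by positivity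
  have hsum : ∀ k, 0 ≤ ‖A ^ k‖ / (s : ℝ) ^ k := fun k => by positivity
  by_cases hn : n < N + 1
  · rw [← div_le_iff₀ hsn]
    have := Finset.single_le_sum (f := fun n => ‖A ^ n‖ / (s : ℝ) ^ n) (fun k _ => hsum k)
      (Finset.mem_range.2 hn)
    linarith
  · have hn1 : 0 < n := by omega
    have h1 := (hN n (by omega)).le
    have h2 : (‖A ^ n‖₊ : ℝ≥0∞) ≤ (s : ℝ≥0∞) ^ n := by
      rw [one_div, ENNReal.rpow_inv_le_iff (by exact_mod_cast hn1)] at h1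
      simpa using h1
    have h3 : ‖A ^ n‖ ≤ (s : ℝ) ^ n := by exact_mod_cast h2
    refine h3.trans ?_
    have := Finset.sum_nonneg (s := Finset.range (N + 1)) (fun k _ => hsum k)
    nlinarith

lemma spectralRadius_le_of_norm_pow_le [CompleteSpace X] (A : X →L[ℂ] X) {s : ℝ≥0} {C : ℝ}
    (h : ∀ n : ℕ, 1 ≤ n → ‖A ^ n‖ ≤ C * (s : ℝ) ^ n) : spectralRadius ℂ A ≤ s := by
  refine iSup₂_le fun z hz => ?_
  rw [ENNReal.coe_le_coe]
  by_contra! hlt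
  have hlt' : (s : ℝ) < ‖z‖ := hlt
  have hz0 : 0 < ‖z‖ := s.2.trans_lt hlt'
  have hbd : ∀ n : ℕ, 1 ≤ n → 1 ≤ C * ‖(1 : X →L[ℂ] X)‖ * ((s : ℝ) / ‖z‖) ^ n := by
    intro n hn
    have h1 := spectrum.norm_le_norm_mul_of_mem (spectrum.pow_mem_pow A n hz)
    rw [norm_pow] at h1
    have h2 := mul_le_mul_of_nonneg_right (h n hn) (norm_nonneg (1 : X →L[ℂ] X))
    rw [div_pow, mul_div_assoc', le_div_iff₀ (by positivity)]
    nlinarith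
  have ht := (tendsto_pow_atTop_nhds_zero_of_lt_one (div_nonneg s.2 hz0.le)
    ((div_lt_one hz0).2 hlt')).const_mul (C * ‖(1 : X →L[ℂ] X)‖)
  rw [mul_zero] at ht
  have := ge_of_tendsto ht (eventually_atTop.2 ⟨1, fun n hn => hbd n hn⟩)
  exact absurd this (by norm_num)

end Operators

end QuasiCompact
namespace QuasiCompact

/-! ### Towers of generalized eigenvectors -/

section Splitting

variable {X : Type*} [NormedAddCommGroup X] [NormedSpace ℂ X]

lemma coverBound_add_of_isCompactOperator (K W : X →L[ℂ] X) (hK : IsCompactOperator K) {β : ℝ}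
    (hβ : ‖W‖ < β) : CoverBound (K + W) β := by
  obtain ⟨C, hC, hsub⟩ := hK.image_closedBall_subset_compact (f := (K : X →ₗ[ℂ] X)) 1
  obtain ⟨t, ht, hcov⟩ := Metric.totallyBounded_iff.1 hC.totallyBounded (β - ‖W‖) (by linarith)
  refine ⟨t, ht, fun x hx => ?_⟩
  have hm : K x ∈ C := hsub ⟨x, by simpa using hx, rfl⟩
  obtain ⟨y, hy, hxy⟩ := Set.mem_iUnion₂.1 (hcov hm)
  refine ⟨y, hy, ?_⟩
  rw [Metric.mem_ball, dist_eq_norm] at hxy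
  have h1 : ‖W x‖ ≤ ‖W‖ := (W.le_opNorm x).trans (mul_le_of_le_one_right (norm_nonneg _) hx)
  have e : (K + W) x - y = (K x - y) + W x := by
    rw [add_apply]; abel
  rw [e]
  refine (norm_add_le _ _).trans ?_
  linarith

/-- Finite dimensional subspaces obtained from `0` by adding successively generalized eigenvectors
of `T` for eigenvalues of modulus at least `ρ`. -/
inductive EigenTower (T : X →L[ℂ] X) (ρ : ℝ≥0) : Submodule ℂ X → Prop
  | bot : EigenTower T ρ ⊥
  | step {F : Submodule ℂ X} (hF : EigenTower T ρ F) {v : X} {z : ℂ} (hz : ρ ≤ ‖z‖₊)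
      (hv : T v - z • v ∈ F) : EigenTower T ρ (F ⊔ Submodule.span ℂ {v})

variable {T : X →L[ℂ] X} {ρ : ℝ≥0} {F : Submodule ℂ X}

lemma EigenTower.finiteDimensional (hF : EigenTower T ρ F) : FiniteDimensional ℂ F := by
  induction hF with
  | bot => infer_instance
  | step _ _ _ ih => exact Submodule.finiteDimensional_sup _ _

lemma EigenTower.map_mem (hF : EigenTower T ρ F) : ∀ v ∈ F, T v ∈ F := by
  induction hF with
  | bot => intro v hv; rw [Submodule.mem_bot] at hv ⊢; rw [hv, map_zero]
  | @step F hF v z hz hv ih =>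
    intro w hw
    obtain ⟨f, hf, g, hg, rfl⟩ := Submodule.mem_sup.1 hw
    obtain ⟨a, rfl⟩ := Submodule.mem_span_singleton.1 hg
    have : T (f + a • v) = (T f + a • (T v - z • v)) + (a * z) • v := by
      rw [map_add, map_smul, smul_sub, smul_smul]; abel
    rw [this]
    exact Submodule.add_mem_sup (F.add_mem (ih f hf) (F.smul_mem a hv))
      (Submodule.smul_mem _ _ (Submodule.mem_span_singleton_self v))

/-- T acts on F ⊔ span {v} modulo F as multiplication by z, so an eigenvector for l ≠ z already lies
in F. For ρ > 0 this makes T invertible on F and bounds the eigenvalues of the inverse. -/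
lemma EigenTower.eq_zero_of_lt (hF : EigenTower T ρ F) :
    ∀ v ∈ F, ∀ z : ℂ, ‖z‖₊ < ρ → T v = z • v → v = 0 := by
  induction hF with
  | bot => intro v hv _ _ _; simpa using hv
  | @step F hF v z hz hv ih =>
    intro w hw l hl hwl
    obtain ⟨f, hf, g, hg, rfl⟩ := Submodule.mem_sup.1 hw
    obtain ⟨a, rfl⟩ := Submodule.mem_span_singleton.1 hg
    have hzl : z - l ≠ 0 := by
      rw [sub_ne_zero]; rintro rfl; exact (hl.trans_le hz).false
    have hav : a • v ∈ F := by
      have h1 : (z - l) • (a • v) = -(T f - l • f) - a • (T v - z • v) := by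
        have h2 : T f + a • T v = l • f + l • a • v := by
          rw [← map_smul, ← map_add, hwl, smul_add]
        have h3 : a • T v = l • f + l • a • v - T f := eq_sub_of_add_eq' h2
        rw [smul_sub, h3, sub_smul, smul_comm a z]
        abel
      have h4 : (z - l) • (a • v) ∈ F := by
        rw [h1]
        exact F.sub_mem (F.neg_mem (F.sub_mem (hF.map_mem f hf) (F.smul_mem l hf)))
          (F.smul_mem a hv)
      exact (F.smul_mem_iff hzl).1 h4
    exact ih _ (F.add_mem hf hav) l hl hwl

/-- Riesz's lemma. As F is invariant, subtracting a vector of F and rescaling preserves the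
eigenvector relation modulo F. -/
lemma exists_unit_far_of_notMem (hF : EigenTower T ρ F) {v : X} (hv : v ∉ F) {z : ℂ}
    (hvz : T v - z • v ∈ F) :
    ∃ x : X, ‖x‖ ≤ 1 ∧ (∀ f ∈ F, 1 / 2 ≤ ‖x - f‖) ∧ T x - z • x ∈ F := by
  have := hF.finiteDimensional
  have hcl : IsClosed (F : Set X) := F.closed_of_finiteDimensional
  have hne : (F : Set X).Nonempty := ⟨0, F.zero_mem⟩
  have hd : 0 < Metric.infDist v (F : Set X) := (hcl.notMem_iff_infDist_pos hne).1 hv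
  obtain ⟨f, hf, hfd⟩ := (Metric.infDist_lt_iff hne).1
    (show Metric.infDist v (F : Set X) < 2 * Metric.infDist v (F : Set X) by linarith)
  rw [dist_eq_norm] at hfd
  set d := Metric.infDist v (F : Set X) with hd_def
  have hn : 0 < ‖v - f‖ := by
    rw [norm_pos_iff, sub_ne_zero]; rintro rfl; exact hv hf
  set c : ℂ := ((‖v - f‖⁻¹ : ℝ) : ℂ) with hc
  have hcn : ‖c‖ = ‖v - f‖⁻¹ := by
    rw [hc, Complex.norm_real, Real.norm_of_nonneg (by positivity)]
  have hc0 : c ≠ 0 := by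
    rw [← norm_pos_iff, hcn]; positivity
  refine ⟨c • (v - f), ?_, fun g hg => ?_, ?_⟩
  · rw [norm_smul, hcn, inv_mul_cancel₀ hn.ne']
  · have e : c • (v - f) - g = c • (v - (f + c⁻¹ • g)) := by
      rw [smul_sub, smul_sub, smul_add, smul_smul, mul_inv_cancel₀ hc0, one_smul]; abel
    have h1 : d ≤ ‖v - (f + c⁻¹ • g)‖ := by
      rw [← dist_eq_norm]
      exact Metric.infDist_le_dist_of_mem (F.add_mem hf (F.smul_mem _ hg))
    rw [e, norm_smul, hcn, inv_mul_eq_div, le_div_iff₀ hn]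
    linarith
  · have e : T (c • (v - f)) - z • c • (v - f) = c • ((T v - z • v) - (T f - z • f)) := by
      simp only [map_smul, map_sub, smul_sub, smul_comm z c]; abel
    rw [e]
    exact F.smul_mem _ (F.sub_mem hvz (F.sub_mem (hF.map_mem f hf) (F.smul_mem z hf)))

lemma EigenTower.pow_mem (hF : EigenTower T ρ F) (m : ℕ) : ∀ v ∈ F, (T ^ m) v ∈ F := by
  induction m with
  | zero => simp
  | succ m ih => intro v hv; rw [pow_succ, mul_apply_eq_comp]; exact ih _ (hF.map_mem v hv)

lemma EigenTower.pow_sub_mem (hF : EigenTower T ρ F) {x : X} {z : ℂ} (hx : T x - z • x ∈ F)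
    (m : ℕ) : (T ^ m) x - z ^ m • x ∈ F := by
  induction m with
  | zero => simp
  | succ m ih =>
    have e : (T ^ (m + 1)) x - z ^ (m + 1) • x =
        T ((T ^ m) x - z ^ m • x) + z ^ m • (T x - z • x) := by
      rw [pow_succ', pow_succ, mul_apply_eq_comp, map_sub, map_smul, smul_sub, smul_smul]
      abel
    rw [e]
    exact F.add_mem (hF.map_mem _ ih) (F.smul_mem _ hx)

/-- The construction of generalized eigenvectors stops. -/
lemma exists_maximal_eigenTower (T : X →L[ℂ] X) (ρ : ℝ≥0) {m : ℕ} {β : ℝ}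
    (hc : CoverBound (T ^ m) β) (hβ : 4 * β < (ρ : ℝ) ^ m) :
    ∃ F, EigenTower T ρ F ∧ ∀ (v : X) (z : ℂ), ρ ≤ ‖z‖₊ → T v - z • v ∈ F → v ∈ F := by
  by_contra! hcon
  have hstep : ∀ F : {F // EigenTower T ρ F}, ∃ (x : X) (z : ℂ), ρ ≤ ‖z‖₊ ∧ ‖x‖ ≤ 1 ∧
      (∀ f ∈ F.1, 1 / 2 ≤ ‖x - f‖) ∧ T x - z • x ∈ F.1 := by
    rintro ⟨F, hF⟩
    obtain ⟨v, z, hz, hv, hvF⟩ := hcon F hF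
    obtain ⟨x, h1, h2, h3⟩ := exists_unit_far_of_notMem hF hvF hv
    exact ⟨x, z, hz, h1, h2, h3⟩
  choose x z hz hx1 hx2 hx3 using hstep
  let G : ℕ → {F // EigenTower T ρ F} := fun n => Nat.rec ⟨⊥, .bot⟩
    (fun _ F => ⟨F.1 ⊔ Submodule.span ℂ {x F}, .step F.2 (hz F) (hx3 F)⟩) n
  have hG : ∀ n, (G (n + 1)).1 = (G n).1 ⊔ Submodule.span ℂ {x (G n)} := fun n => rfl
  have hmono : Monotone fun n => (G n).1 := monotone_nat_of_le_succ fun n => by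
    rw [hG]; exact le_sup_left
  have hxm : ∀ n, x (G n) ∈ (G (n + 1)).1 := fun n => by
    rw [hG]; exact Submodule.mem_sup_right (Submodule.mem_span_singleton_self _)
  obtain ⟨t, ht, hcov⟩ := hc
  choose y hyt hy using fun n => hcov (x (G n)) (hx1 (G n))
  have : Finite t := ht
  -- Two images share a centre, hence are within 2β. The later one equals w^m times its vector
  -- modulo the tower containing the earlier image, so they are at least ρ^m / 2 apart; this is
  -- where the factor 4 comes from.
  obtain ⟨i, j, hij, heq⟩ := Finite.exists_ne_map_eq_of_infinite (fun n => (⟨y n, hyt n⟩ : t))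
  have hyij : y i = y j := congrArg Subtype.val heq
  clear heq
  wlog hlt : i < j generalizing i j
  · exact this j i hij.symm hyij.symm (lt_of_le_of_ne (not_lt.1 hlt) hij.symm)
  have hclose : ‖(T ^ m) (x (G j)) - (T ^ m) (x (G i))‖ ≤ 2 * β := by
    have e : (T ^ m) (x (G j)) - (T ^ m) (x (G i)) =
      ((T ^ m) (x (G j)) - y j) - ((T ^ m) (x (G i)) - y i) := by rw [hyij]; abel
    rw [e]
    refine (norm_sub_le _ _).trans ?_
    linarith [hy i, hy j]
  set w := z (G j) with hw
  have hwρ : (ρ : ℝ) ≤ ‖w‖ := hz (G j)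
  have hρ0 : 0 < (ρ : ℝ) ^ m := by
    have : 0 ≤ β := (norm_nonneg _).trans (hy 0)
    linarith
  have hwm : (ρ : ℝ) ^ m ≤ ‖w ^ m‖ := by
    rw [norm_pow]; exact pow_le_pow_left₀ ρ.2 hwρ m
  have hw0 : w ^ m ≠ 0 := norm_pos_iff.1 (hρ0.trans_le hwm)
  have hmem : (T ^ m) (x (G i)) - ((T ^ m) (x (G j)) - w ^ m • x (G j)) ∈ (G j).1 :=
    Submodule.sub_mem _ ((G j).2.pow_mem m _ (hmono hlt (hxm i)))
      ((G j).2.pow_sub_mem (hx3 (G j)) m)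
  have hfar := hx2 (G j) _ ((G j).1.smul_mem (w ^ m)⁻¹ hmem)
  have e : (T ^ m) (x (G j)) - (T ^ m) (x (G i)) = w ^ m • (x (G j) - (w ^ m)⁻¹ •
      ((T ^ m) (x (G i)) - ((T ^ m) (x (G j)) - w ^ m • x (G j)))) := by
    rw [smul_sub (w ^ m), smul_smul, mul_inv_cancel₀ hw0, one_smul]; abel
  rw [e, norm_smul] at hclose
  nlinarith [norm_nonneg (w ^ m)]

end Splitting

end QuasiCompact
namespace QuasiCompact

/-! ### Invariant complements and the splitting theorem -/

section Splitting

variable {X : Type*} [NormedAddCommGroup X] [NormedSpace ℂ X]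

/-- An upper triangular block operator whose diagonal blocks have separated growth can be block
diagonalized: if `P₀` is a projection onto an invariant subspace `F`, if `G` inverts `T` on `F` and
`G`, `(1 - P₀) T` have geometric growth with ratios of product `< 1`, there is a projection onto `F`
that commutes with `T`. -/
lemma exists_commuting_projection [CompleteSpace X] {T P₀ G : X →L[ℂ] X} {F : Submodule ℂ X}
    (hF : ∀ v ∈ F, T v ∈ F) (hFc : IsClosed (F : Set X))
    (hP₀F : ∀ x, P₀ x ∈ F) (hP₀ : ∀ x ∈ F, P₀ x = x)
    (hGF : ∀ x, G x ∈ F) (hG : ∀ x ∈ F, T (G x) = x)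
    {C₁ C₂ s g : ℝ} (hs : ∀ n, ‖((1 - P₀) * T) ^ n‖ ≤ C₁ * s ^ n)
    (hg : ∀ n, ‖G ^ n‖ ≤ C₂ * g ^ n) (hs0 : 0 ≤ s) (hg0 : 0 ≤ g) (hsg : s * g < 1) :
    ∃ P : X →L[ℂ] X, (∀ x, P x ∈ F) ∧ (∀ x ∈ F, P x = x) ∧ T * P = P * T := by
  set S := (1 - P₀) * T with hS
  set D := P₀ * T - T * P₀ with hD
  clear_value S D
  have hC₁ : 0 ≤ C₁ := by simpa using (norm_nonneg _).trans (hs 0)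
  have hC₂ : 0 ≤ C₂ := by simpa using (norm_nonneg _).trans (hg 0)
  have hDF : ∀ x, D x ∈ F := fun x => by
    rw [hD]; exact F.sub_mem (hP₀F (T x)) (hF _ (hP₀F x))
  have hD0 : ∀ x ∈ F, D x = 0 := fun x hx => by
    simp [hD, hP₀ x hx, hP₀ _ (hF x hx)]
  have hS0 : ∀ x ∈ F, S x = 0 := fun x hx => by
    simp [hS, hP₀ _ (hF x hx)]
  have hDS : D * T = D * S := by
    ext x
    have h1 : T x = S x + P₀ (T x) := by simp [hS]
    change D (T x) = D (S x)
    rw [h1, map_add, hD0 _ (hP₀F _), add_zero]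
  have hST : S * T = S * S := by
    ext x
    have h1 : T x = S x + P₀ (T x) := by simp [hS]
    change S (T x) = S (S x)
    rw [h1, map_add, hS0 _ (hP₀F _), add_zero]
  have hDSn : ∀ n, D * S ^ n * T = D * S ^ (n + 1) := by
    intro n
    cases n with
    | zero => simpa using hDS
    | succ n => rw [pow_succ S (n + 1), pow_succ, mul_assoc, mul_assoc (S ^ n), hST, mul_assoc (S ^ n)]
  have hTG : ∀ n, T * (G ^ (n + 1) * D) = G ^ n * D := by
    intro n
    ext x
    have hmem : ∀ k, (G ^ k) (D x) ∈ F := by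
      intro k
      cases k with
      | zero => simpa using hDF x
      | succ k => rw [pow_succ', mul_apply_eq_comp]; exact hGF _
    rw [pow_succ']
    simpa using hG _ (hmem n)
  -- The sum B of this series solves T B - B T = D, so P₀ + B commutes with T: T * a (n + 1) = a n *
  -- T, and the leftover term T * a 0 is D.
  set a : ℕ → X →L[ℂ] X := fun n => G ^ (n + 1) * D * S ^ n with ha
  have hsum : Summable a := by
    refine Summable.of_norm_bounded (g := fun n => C₂ * g * ‖D‖ * C₁ * (s * g) ^ n)
      ((summable_geometric_of_lt_one (by positivity) hsg).mul_left _) fun n => ?_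
    calc ‖a n‖ ≤ ‖G ^ (n + 1)‖ * ‖D‖ * ‖S ^ n‖ :=
          (norm_mul_le _ _).trans (mul_le_mul_of_nonneg_right (norm_mul_le _ _) (norm_nonneg _))
      _ ≤ (C₂ * g ^ (n + 1)) * ‖D‖ * (C₁ * s ^ n) := by
          gcongr
          · exact hg _
          · exact hs _
      _ = _ := by rw [mul_pow, pow_succ]; ring
  obtain ⟨B, hB⟩ := hsum
  have hBapp : ∀ x, HasSum (fun n => a n x) (B x) := fun x =>
    hB.mapL (ContinuousLinearMap.apply ℂ X x)
  refine ⟨P₀ + B, fun x => F.add_mem (hP₀F x) ?_, fun x hx => ?_, ?_⟩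
  · refine hFc.mem_of_tendsto (hBapp x) (Eventually.of_forall fun t => F.sum_mem fun n _ => ?_)
    simp only [ha, pow_succ', mul_apply_eq_comp, mul_assoc]
    exact hGF _
  · have h0 : ∀ n, a n x = 0 := by
      intro n
      cases n with
      | zero => simp [ha, hD0 x hx]
      | succ n => simp [ha, pow_succ S, hS0 x hx]
    have hB0 : B x = 0 := by
      refine (hBapp x).unique ?_
      simp only [h0]
      exact hasSum_zero
    rw [add_apply, hP₀ x hx, hB0, add_zero]
  · have h1 : HasSum (fun n => T * a n) (T * B) := hB.mul_left T
    have h2 : HasSum (fun n => a n * T) (B * T) := hB.mul_right T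
    have h3 : ∀ n, T * a (n + 1) = a n * T := by
      intro n
      simp only [ha]
      rw [← mul_assoc, hTG, mul_assoc, mul_assoc (G ^ (n + 1)), mul_assoc (G ^ (n + 1)), hDSn]
    have h4 : T * a 0 = D := by
      simp only [ha, pow_zero, mul_one]
      rw [hTG]; simp
    have h5 := (hasSum_nat_add_iff' 1).2 h1
    simp only [h3, Finset.sum_range_one, h4] at h5
    have h6 := h5.unique h2
    rw [mul_add, add_mul, ← h6, hD]
    abel

/-- If some power of `T` is, up to a finite covering, small compared with `ρ`, then `T` admits a
spectral splitting at `ρ`. -/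
theorem hasSplitting_of_coverBound [CompleteSpace X] (T : X →L[ℂ] X) {ρ : ℝ≥0} {m : ℕ} {β : ℝ}
    (hc : CoverBound (T ^ m) β) (hβ : β < (ρ : ℝ) ^ m) (hρ : 0 < ρ) : HasSplitting T ρ := by
  have hρ' : (0 : ℝ) < ρ := hρ
  -- High powers gain any fixed factor, enough to absorb the 1/4 for the tower and the norm of 1 -
  -- P₀.
  have hsmall : ∀ ε : ℝ, 0 < ε → ∃ k γ, CoverBound (T ^ k) γ ∧ γ < ε * (ρ : ℝ) ^ k := by
    intro ε hε
    have hq : β / (ρ : ℝ) ^ m < 1 := by rwa [div_lt_one (by positivity)]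
    have hq0 : 0 ≤ β / (ρ : ℝ) ^ m := div_nonneg hc.nonneg (by positivity)
    obtain ⟨j, hj⟩ := exists_pow_lt_of_lt_one hε hq
    refine ⟨m * j, β ^ j, by rw [pow_mul]; exact hc.pow j, ?_⟩
    rwa [div_pow, ← pow_mul, div_lt_iff₀ (by positivity)] at hj
  obtain ⟨k₁, γ₁, hk₁, hγ₁⟩ := hsmall (1 / 4) (by norm_num)
  obtain ⟨F, hF, hmax⟩ := exists_maximal_eigenTower T ρ hk₁ (by linarith)
  have hfd := hF.finiteDimensional
  have hFc : IsClosed (F : Set X) := F.closed_of_finiteDimensional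
  obtain ⟨p, hp⟩ := Submodule.ClosedComplemented.of_finiteDimensional (𝕜 := ℂ) F
  set P₀ : X →L[ℂ] X := F.subtypeL ∘L p with hP₀_def
  have hP₀F : ∀ x, P₀ x ∈ F := fun x => (p x).2
  have hP₀ : ∀ x ∈ F, P₀ x = x := fun x hx => congrArg Subtype.val (hp ⟨x, hx⟩)
  set S := (1 - P₀) * T with hS
  have hSrange : ∀ x, P₀ (S x) = 0 := fun x => by
    simp [hS, hP₀ _ (hP₀F (T x))]
  -- the complementary block has small spectral radius
  have hSpow : ∀ n, (1 - P₀) * T ^ (n + 1) = S ^ (n + 1) := by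
    intro n
    induction n with
    | zero => simp [hS]
    | succ n ih =>
      have h1 : (1 - P₀) * T * P₀ = 0 := by
        ext x; simp [hP₀ _ (hF.map_mem _ (hP₀F x))]
      rw [pow_succ' S, ← ih, pow_succ' T, hS]
      have : (1 - P₀) * T * ((1 - P₀) * T ^ (n + 1)) =
        (1 - P₀) * T * T ^ (n + 1) - (1 - P₀) * T * P₀ * T ^ (n + 1) := by noncomm_ring
      rw [this, h1, zero_mul, sub_zero, mul_assoc]
  have hSr : spectralRadius ℂ S < ρ := by
    obtain ⟨k, γ, hk, hγ⟩ := hsmall (1 / (‖1 - P₀‖ + 1)) (by positivity)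
    have hN : 0 < ‖1 - P₀‖ + 1 := by positivity
    have hcov : CoverBound (S ^ k) (γ * (‖1 - P₀‖ + 1)) := by
      cases k with
      | zero =>
        rw [pow_zero] at hk ⊢
        exact hk.mono (le_mul_of_one_le_right hk.nonneg (by linarith [norm_nonneg (1 - P₀)]))
      | succ k =>
        rw [← hSpow]
        exact ((coverBound_norm (1 - P₀)).mono (by linarith)).comp hk
    refine spectralRadius_lt_of_coverBound S hρ hcov ?_ ?_
    · rwa [one_div, inv_mul_eq_div, lt_div_iff₀ hN] at hγ
    -- Such an eigenvector of S satisfies T x - z • x ∈ F, so maximality of the tower puts it in F;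
    -- yet P₀ kills it.
    · intro z x hz hx
      have hz0 : z ≠ 0 := by
        rintro rfl
        rw [nnnorm_zero] at hz
        exact hρ.not_ge hz
      have hP₀x : P₀ x = 0 := by
        have := hSrange x
        rw [hx, map_smul] at this
        exact (smul_eq_zero.1 this).resolve_left hz0
      have hmem : T x - z • x ∈ F := by
        have : T x - z • x = P₀ (T x) := by
          rw [← hx]; simp [hS]
        rw [this]; exact hP₀F _
      rw [← hP₀ x (hmax x z hz hmem), hP₀x]
  obtain ⟨s, hsρ, C₁, hC₁⟩ := exists_norm_pow_le_of_spectralRadius_lt S hSr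
  -- the inverse of `T` on `F`
  have hinj : Function.Injective ((T : X →ₗ[ℂ] X).restrict hF.map_mem) := by
    rw [← LinearMap.ker_eq_bot, LinearMap.ker_eq_bot']
    intro v hv
    have h1 : T v = (0 : ℂ) • (v : X) := by
      rw [zero_smul]; exact congrArg Subtype.val hv
    exact Subtype.ext (hF.eq_zero_of_lt v v.2 0 (by simpa using hρ) h1)
  let e := LinearEquiv.ofInjectiveEndo _ hinj
  let i : F →L[ℂ] F := LinearMap.toContinuousLinearMap (e.symm : F →ₗ[ℂ] F)
  set G : X →L[ℂ] X := F.subtypeL ∘L i ∘L p with hG_def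
  have hGF : ∀ x, G x ∈ F := fun x => (i (p x)).2
  have hG : ∀ x ∈ F, T (G x) = x := by
    intro x hx
    have h1 : e (e.symm (p x)) = p x := e.apply_symm_apply _
    have h2 : T (G x) = ((e (e.symm (p x)) : F) : X) := rfl
    rw [h2, h1]
    exact hP₀ x hx
  have hGcomp : IsCompactOperator G := by
    have h1 : IsCompactOperator (i ∘L p : X →L[ℂ] F) :=
      isCompactOperator_of_locallyCompactSpace_dom (T := i ∘L p)
    exact h1.clm_comp F.subtypeL
  -- Eigenvalues of G on F have modulus at most ρ⁻¹ < σ⁻¹; with s < σ this yields s * g < 1.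
  obtain ⟨σ, hsσ, hσρ⟩ := exists_between hsρ
  have hσ0 : 0 < σ := (zero_le).trans_lt hsσ
  have hGr : spectralRadius ℂ G < (σ⁻¹ : ℝ≥0) := by
    have hσi : (0 : ℝ) < (σ⁻¹ : ℝ≥0) := by exact_mod_cast inv_pos.2 hσ0
    refine spectralRadius_lt_of_coverBound G (m := 1) (β := (σ⁻¹ : ℝ≥0) / 2)
      (inv_pos.2 hσ0) ?_ (by rw [pow_one]; linarith) ?_
    · rw [pow_one, ← add_zero G]
      exact coverBound_add_of_isCompactOperator G 0 hGcomp (by rw [norm_zero]; positivity)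
    · intro z x hz hx
      have hz0 : z ≠ 0 := by
        rintro rfl
        rw [nnnorm_zero] at hz
        exact (inv_pos.2 hσ0).not_ge hz
      have hxF : x ∈ F := by
        have := hGF x
        rw [hx] at this
        exact (F.smul_mem_iff hz0).1 this
      have hTx : T x = z⁻¹ • x := by
        have := hG x hxF
        rw [hx, map_smul] at this
        rw [eq_inv_smul_iff₀ hz0, this]
      refine hF.eq_zero_of_lt x hxF z⁻¹ ?_ hTx
      rw [nnnorm_inv]
      exact (inv_le_of_inv_le₀ hσ0 hz).trans_lt hσρ
  obtain ⟨g, hgσ, C₂, hC₂⟩ := exists_norm_pow_le_of_spectralRadius_lt G hGr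
  have hsg : (s : ℝ) * g < 1 := by
    have : s * g < 1 := by
      calc s * g ≤ σ * g := by gcongr
        _ < σ * σ⁻¹ := by gcongr
        _ = 1 := mul_inv_cancel₀ hσ0.ne'
    exact_mod_cast this
  obtain ⟨P, hPF, hPid, hPT⟩ := exists_commuting_projection hF.map_mem hFc hP₀F hP₀ hGF hG hC₁ hC₂
    s.2 g.2 hsg
  have hH : ∀ v ∈ LinearMap.ker (P : X →ₗ[ℂ] X), T v ∈ LinearMap.ker (P : X →ₗ[ℂ] X) := by
    intro v hv
    have hv' : P v = 0 := hv
    have : P (T v) = 0 := by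
      rw [← mul_apply_eq_comp, ← hPT, mul_apply_eq_comp, hv', map_zero]
    exact this
  have hHc : IsClosed (LinearMap.ker (P : X →ₗ[ℂ] X) : Set X) := P.isClosed_ker
  have : CompleteSpace (LinearMap.ker (P : X →ₗ[ℂ] X)) := hHc.completeSpace_coe
  refine ⟨F, LinearMap.ker (P : X →ₗ[ℂ] X), hF.map_mem, hH, ?_, hHc, ?_, hfd, ?_⟩
  · refine ⟨?_, ?_⟩
    · rw [Submodule.disjoint_def]
      intro x hx hx'
      rw [← hPid x hx]; exact hx'
    · rw [codisjoint_iff, eq_top_iff]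
      intro x _
      have : x = P x + (x - P x) := by abel
      rw [this]
      refine Submodule.add_mem_sup (hPF x) ?_
      have : P (x - P x) = 0 := by rw [map_sub, hPid _ (hPF x), sub_self]
      exact this
  · refine lt_of_le_of_lt (spectralRadius_le_of_norm_pow_le (s := s) (C := ‖1 - P‖ * C₁) _ ?_)
      (by exact_mod_cast hsρ)
    intro n hn
    have hC₁0 : 0 ≤ C₁ := by simpa using (norm_nonneg _).trans (hC₁ 0)
    have hpow : ∀ (n : ℕ) (v : LinearMap.ker (P : X →ₗ[ℂ] X)),
        (((T.restrict hH) ^ n) v : X) = (T ^ n) v := by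
      intro n
      induction n with
      | zero => intro v; simp
      | succ n ih => intro v; rw [pow_succ, pow_succ, mul_apply_eq_comp, ih]; rfl
    refine ContinuousLinearMap.opNorm_le_bound _ (by positivity) fun v => ?_
    obtain ⟨n, rfl⟩ : ∃ k, n = k + 1 := ⟨n - 1, by omega⟩
    -- 1 - P kills F and fixes the kernel of P, so T^(n+1) v is recovered from its class modulo F,
    -- whose growth the powers of S control.
    have h1 : (T ^ (n + 1)) (v : X) = (1 - P) ((S ^ (n + 1)) v) := by
      have hker : P ((T ^ (n + 1)) (v : X)) = 0 := by
        rw [← hpow]; exact (((T.restrict hH) ^ (n + 1)) v).2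
      rw [← hSpow, mul_apply_eq_comp]
      generalize (T ^ (n + 1)) (v : X) = y at hker ⊢
      simp [hPid _ (hP₀F _), hker]
    have h2 : ‖((T.restrict hH) ^ (n + 1)) v‖ = ‖(T ^ (n + 1)) (v : X)‖ := by
      rw [← hpow]; rfl
    rw [h2, h1]
    calc _ ≤ ‖1 - P‖ * (‖S ^ (n + 1)‖ * ‖(v : X)‖) :=
          (ContinuousLinearMap.le_opNorm _ _).trans
            (mul_le_mul_of_nonneg_left (ContinuousLinearMap.le_opNorm _ _) (norm_nonneg _))
      _ ≤ ‖1 - P‖ * ((C₁ * (s : ℝ) ^ (n + 1)) * ‖(v : X)‖) := by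
          gcongr; exact hC₁ _
      _ = _ := by rw [Submodule.coe_norm]; ring
  · intro z hz
    by_contra! hlt
    obtain ⟨v, hv⟩ := hz.exists_hasEigenvector
    have h1 : T v = z • (v : X) := congrArg Subtype.val hv.apply_eq_smul
    exact hv.2 (Subtype.ext (hF.eq_zero_of_lt v v.2 z hlt h1))

end Splitting

end QuasiCompact
namespace QuasiCompact

/-! ### Finite-dimensional approximation and sampling -/

section Sampling

variable {X : Type*} [NormedAddCommGroup X] [NormedSpace ℂ X]

/-- On a finite dimensional space the norm is controlled by finitely many members of a separating
family of linear forms. -/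
lemma exists_sampling {E : Type*} (ev : E → X →ₗ[ℂ] ℂ) (hsep : ∀ g, (∀ y, ev y g = 0) → g = 0)
    (F : Submodule ℂ X) [FiniteDimensional ℂ F] :
    ∃ (t : Finset E) (C : ℝ≥0), ∀ g ∈ F, ‖g‖ ≤ C * ∑ y ∈ t, ‖ev y g‖ := by
  let Φ : ∀ t : Finset E, F →ₗ[ℂ] (t → ℂ) := fun t => LinearMap.pi fun y => (ev y).domRestrict F
  -- A minimal common kernel of finitely many forms is zero, since one more form would cut out any
  -- nonzero element.
  obtain ⟨_, ⟨t, rfl⟩, hmin⟩ := IsArtinian.set_has_minimal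
    (Set.range fun t : Finset E => LinearMap.ker (Φ t)) (Set.range_nonempty _)
  have hker : LinearMap.ker (Φ t) = ⊥ := by
    rw [LinearMap.ker_eq_bot']
    intro g hg
    by_contra hne
    obtain ⟨y, hy⟩ : ∃ y, ev y g ≠ 0 := by
      by_contra! h
      exact hne (Subtype.ext (hsep g h))
    classical
    refine hmin _ ⟨insert y t, rfl⟩ (lt_of_le_of_ne ?_ ?_)
    · intro f hf
      rw [LinearMap.mem_ker] at hf ⊢
      funext z
      exact congrFun hf ⟨z.1, Finset.mem_insert_of_mem z.2⟩
    · intro heq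
      have : g ∈ LinearMap.ker (Φ (insert y t)) := by
        have heq' : LinearMap.ker (Φ (insert y t)) = LinearMap.ker (Φ t) := heq
        rw [heq']; exact hg
      exact hy (congrFun (LinearMap.mem_ker.1 this) ⟨y, Finset.mem_insert_self _ _⟩)
  obtain ⟨K, -, hK⟩ := (Φ t).exists_antilipschitzWith hker
  refine ⟨t, K, fun g hg => ?_⟩
  have h1 : ‖g‖ ≤ K * ‖Φ t ⟨g, hg⟩‖ := by
    simpa using hK.le_mul_dist ⟨g, hg⟩ 0
  refine h1.trans ?_
  gcongr
  rw [pi_norm_le_iff_of_nonneg (Finset.sum_nonneg fun _ _ => norm_nonneg _)]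
  intro y
  exact Finset.single_le_sum (f := fun y => ‖ev y g‖) (fun _ _ => norm_nonneg _) y.2

lemma eventually_mul_pow_le {s a : ℝ≥0} (h : s < a) (C : ℝ) :
    ∀ᶠ n : ℕ in atTop, C * (s : ℝ) ^ n ≤ (a : ℝ) ^ n := by
  have ha : (0 : ℝ) < a := lt_of_le_of_lt s.2 h
  have ht := (tendsto_pow_atTop_nhds_zero_of_lt_one (div_nonneg s.2 ha.le)
    ((div_lt_one ha).2 h)).const_mul C
  rw [mul_zero] at ht
  filter_upwards [ht.eventually (ge_mem_nhds one_pos)] with n hn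
  rwa [div_pow, mul_div_assoc', div_le_one (by positivity)] at hn

/-- Below the essential spectral radius, the powers of an operator are geometrically close to a
fixed finite dimensional space. -/
lemma exists_finiteDimensional_approx [CompleteSpace X] (T : X →L[ℂ] X) {a : ℝ≥0}
    (h : essSpectralRadius T < a) :
    ∃ F : Submodule ℂ X, FiniteDimensional ℂ F ∧ ∃ s : ℝ≥0, s < a ∧ ∃ C : ℝ,
      ∀ (n : ℕ) (f : X), ∃ g ∈ F, ‖(T ^ n) f - g‖ ≤ C * (s : ℝ) ^ n * ‖f‖ := by
  rw [essSpectralRadius, inf_lt_iff] at h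
  rcases h with h | h
  · obtain ⟨s, hs, C, hC⟩ := exists_norm_pow_le_of_spectralRadius_lt T h
    refine ⟨⊥, inferInstance, s, hs, C, fun n f => ⟨0, Submodule.zero_mem _, ?_⟩⟩
    rw [sub_zero]
    exact ((T ^ n).le_opNorm f).trans (mul_le_mul_of_nonneg_right (hC n) (norm_nonneg _))
  · simp only [iInf_lt_iff] at h
    obtain ⟨ρ, ⟨F, H, hF, hH, hFH, hHc, hr, hfd, -⟩, hρ⟩ := h
    have hρa : ρ < a := by exact_mod_cast hρ
    have : CompleteSpace H := hHc.completeSpace_coe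
    obtain ⟨s, hs, C, hC⟩ := exists_norm_pow_le_of_spectralRadius_lt _ hr
    have htop := Submodule.IsCompl.isTopCompl_of_isClosed_of_finiteDimensional hFH.symm hHc
    set R := H.projectionL F htop with hR
    have hRH : ∀ f, R f ∈ H := Submodule.projectionL_apply_mem htop
    have hRF : ∀ f, f - R f ∈ F := fun f => by
      rw [← Submodule.projectionL_apply_eq_zero_iff htop, map_sub, sub_eq_zero]
      exact (Submodule.projectionL_apply_left htop ⟨R f, hRH f⟩).symm
    have hC0 : 0 ≤ C := by simpa using (norm_nonneg _).trans (hC 0)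
    have hpow : ∀ (n : ℕ) (v : H), (((T.restrict hH) ^ n) v : X) = (T ^ n) v := by
      intro n
      induction n with
      | zero => intro v; simp
      | succ n ih => intro v; rw [pow_succ, pow_succ, mul_apply_eq_comp, ih]; rfl
    have hFpow : ∀ (n : ℕ), ∀ v ∈ F, (T ^ n) v ∈ F := by
      intro n
      induction n with
      | zero => intro v hv; simpa using hv
      | succ n ih => intro v hv; rw [pow_succ, mul_apply_eq_comp]; exact ih _ (hF v hv)
    refine ⟨F, hfd, s, hs.trans hρa, C * ‖R‖, fun n f => ⟨_, hFpow n _ (hRF f), ?_⟩⟩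
    have h1 : (T ^ n) f - (T ^ n) (f - R f) = (((T.restrict hH) ^ n) ⟨R f, hRH f⟩ : H) := by
      rw [hpow, ← map_sub, sub_sub_cancel]
    rw [h1, ← Submodule.coe_norm]
    calc _ ≤ ‖(T.restrict hH) ^ n‖ * ‖(⟨R f, hRH f⟩ : H)‖ := ContinuousLinearMap.le_opNorm _ _
      _ ≤ (C * (s : ℝ) ^ n) * (‖R‖ * ‖f‖) := by
          gcongr
          · exact hC n
          · exact R.le_opNorm f
      _ = _ := by ring

/-- T^l f is within a multiple of s^l, s < a, of a vector controlled by its sampled values. The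
sample is fixed before l, so the constants do not grow with l and a^l absorbs the error. -/
lemma exists_sampling_control [CompleteSpace X] (T : X →L[ℂ] X) {a : ℝ≥0}
    (h : essSpectralRadius T < a) {E : Type*} (ev : E → X →ₗ[ℂ] ℂ)
    (hev : ∀ y g, ‖ev y g‖ ≤ ‖g‖) (hsep : ∀ g, (∀ y, ev y g = 0) → g = 0) (L : ℕ) :
    ∃ l, L ≤ l ∧ ∃ (t : Finset E) (C : ℝ≥0), ∀ x (f : X), ‖f‖ ≤ 1 →
      ‖ev x ((T ^ l) f)‖ ≤ C * ∑ y ∈ t, ‖ev y ((T ^ l) f)‖ + (a : ℝ) ^ l := by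
  obtain ⟨F, hfd, s, hs, C, hC⟩ := exists_finiteDimensional_approx T h
  obtain ⟨t, K, hK⟩ := exists_sampling ev hsep F
  obtain ⟨l, hl, hl'⟩ := ((eventually_mul_pow_le hs ((K * t.card + 1) * |C|)).and
    (eventually_ge_atTop L)).exists
  refine ⟨l, hl', t, K, fun x f hf => ?_⟩
  obtain ⟨g, hg, hgf⟩ := hC l f
  set b : ℝ := |C| * (s : ℝ) ^ l with hb
  have hgb : ‖(T ^ l) f - g‖ ≤ b := by
    refine hgf.trans ?_
    have h1 : C * (s : ℝ) ^ l ≤ b := mul_le_mul_of_nonneg_right (le_abs_self C) (by positivity)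
    have h2 : 0 ≤ b := by positivity
    nlinarith [norm_nonneg f]
  have hRy : ∀ y, ‖ev y ((T ^ l) f) - ev y g‖ ≤ b := fun y => by
    rw [← map_sub]; exact (hev y _).trans hgb
  have h1 : ∑ y ∈ t, ‖ev y g‖ ≤ ∑ y ∈ t, ‖ev y ((T ^ l) f)‖ + t.card * b := by
    rw [← nsmul_eq_mul, ← Finset.sum_const, ← Finset.sum_add_distrib]
    refine Finset.sum_le_sum fun y _ => ?_
    have h3 := norm_sub_norm_le (ev y g) (ev y ((T ^ l) f))
    rw [norm_sub_rev] at h3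
    linarith [hRy y]
  have h2 : ‖ev x ((T ^ l) f)‖ ≤ ‖g‖ + b := by
    have h3 := norm_sub_norm_le (ev x ((T ^ l) f)) (ev x g)
    linarith [hRy x, hev x g]
  have h4 := mul_le_mul_of_nonneg_left h1 K.2
  have h5 := hK g hg
  have h6 : (K * t.card + 1) * |C| * (s : ℝ) ^ l = K * (t.card * b) + b := by rw [hb]; ring
  rw [h6] at hl
  change (K : ℝ) * _ ≤ K * _ at h4
  rw [mul_add] at h4
  linarith

end Sampling

/-! ### Kernels as operators on bounded functions -/

section KernelOperators

variable {E : Type*} [MeasurableSpace E]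

lemma bddMeas_norm_le_of_forall {f : bddMeas E} {C : ℝ} (hC : 0 ≤ C) (h : ∀ x, ‖f.1 x‖ ≤ C) :
    ‖f‖ ≤ C :=
  lp.norm_le_of_forall_le hC h

lemma isClosed_bddMeas : IsClosed (bddMeas E : Set (lp (fun _ : E => ℂ) ∞)) := by
  refine IsSeqClosed.isClosed fun u f hu hf => ?_
  refine measurable_of_tendsto_metrizable (f := fun n => (u n : E → ℂ)) (fun n => hu n)
    (tendsto_pi_nhds.2 fun x => ?_)
  rw [tendsto_iff_norm_sub_tendsto_zero] at hf ⊢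
  exact squeeze_zero (fun _ => norm_nonneg _)
    (fun n => lp.norm_apply_le_norm ENNReal.top_ne_zero (u n - f) x) hf

instance completeSpace_bddMeas : CompleteSpace (bddMeas E) :=
  isClosed_bddMeas.completeSpace_coe

/-- A bounded measurable function as an element of `bddMeas E`. -/
def bddMeasOf (f : E → ℂ) (hf : Measurable f) (C : ℝ) (hC : ∀ x, ‖f x‖ ≤ C) : bddMeas E :=
  ⟨⟨f, memℓp_infty ⟨C, by rintro _ ⟨x, rfl⟩; exact hC x⟩⟩, hf⟩

/-- The indicator function of a measurable set as an element of `bddMeas E`. -/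
noncomputable def indicatorBdd (A : Set E) (hA : MeasurableSet A) : bddMeas E :=
  bddMeasOf (A.indicator 1) (measurable_one.indicator hA) 1 fun x =>
    (norm_indicator_le_norm_self _ x).trans (by simp)

lemma norm_indicatorBdd_le (A : Set E) (hA : MeasurableSet A) : ‖indicatorBdd A hA‖ ≤ 1 :=
  bddMeas_norm_le_of_forall zero_le_one fun x =>
    (norm_indicator_le_norm_self (1 : E → ℂ) x).trans (by simp)

lemma kernelOp_indicatorBdd (Q : Kernel E E) [IsFiniteKernel Q] (A : Set E) (hA : MeasurableSet A)
    (x : E) : (kernelOp Q (indicatorBdd A hA)).1 x = ((Q x).real A : ℂ) := by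
  rw [kernelOp_apply]
  have : ∫ y, A.indicator (1 : E → ℂ) y ∂(Q x) = ((Q x).real A : ℂ) := by
    rw [integral_indicator hA]
    simp
  exact this

lemma measure_le_of_kernelOp_norm (Q : Kernel E E) [IsFiniteKernel Q] (x : E) :
    Q x Set.univ ≤ ‖kernelOp Q‖₊ := by
  have h2 := (bddMeas_norm_le (kernelOp Q (indicatorBdd Set.univ .univ)) x).trans
    ((kernelOp Q).unit_le_opNorm _ (norm_indicatorBdd_le _ _))
  rw [kernelOp_indicatorBdd, Complex.norm_real, Real.norm_of_nonneg measureReal_nonneg] at h2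
  rw [← ofReal_measureReal]
  exact ENNReal.ofReal_le_of_le_toReal h2

lemma norm_kernelOp_le (Q : Kernel E E) [IsFiniteKernel Q] {c : ℝ≥0}
    (h : ∀ x, Q x Set.univ ≤ c) : ‖kernelOp Q‖ ≤ c := by
  refine ContinuousLinearMap.opNorm_le_bound _ c.2 fun f => ?_
  refine bddMeas_norm_le_of_forall (by positivity) fun x => ?_
  rw [kernelOp_apply]
  have h1 := norm_integral_le_of_norm_le_const (μ := Q x)
    (Eventually.of_forall (bddMeas_norm_le f))
  refine h1.trans ?_
  rw [mul_comm]
  gcongr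
  exact ENNReal.toReal_le_coe_of_le_coe (h x)

/-- Kernels compose as they act on measures, hence the reversed order on functions. -/
lemma kernelOp_mul (κ η : Kernel E E) [IsFiniteKernel κ] [IsFiniteKernel η]
    [IsFiniteKernel (κ * η)] : kernelOp (κ * η) = kernelOp η * kernelOp κ := by
  ext f x
  change ∫ y, f.1 y ∂((κ ∘ₖ η) x) = ∫ y, (∫ z, f.1 z ∂(κ y)) ∂(η x)
  have : IsFiniteMeasure ((κ ∘ₖ η) x) := inferInstanceAs (IsFiniteMeasure ((κ * η) x))
  exact Kernel.integral_comp (bddMeas_integrable f _)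

set_option synthInstance.maxHeartbeats 200000 in
lemma kernelOp_pow (Q : Kernel E E) [IsFiniteKernel Q] (n : ℕ) :
    kernelOp (Q ^ n) = kernelOp Q ^ n := by
  induction n with
  | zero =>
    ext f x
    change ∫ y, f.1 y ∂((Kernel.id : Kernel E E) x) = f.1 x
    rw [Kernel.id_apply, integral_dirac' _ _ (Measurable.stronglyMeasurable f.2)]
  | succ n ih =>
    have : IsFiniteKernel (Q ^ n * Q) := by rw [← pow_succ]; infer_instance
    have h : kernelOp (Q ^ (n + 1)) = kernelOp (Q ^ n * Q) := by congr 1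
    rw [h, kernelOp_mul, ih, pow_succ']

set_option synthInstance.maxHeartbeats 200000 in
/-- Below the essential spectral radius, the iterated kernels are controlled by finitely many of
their rows. -/
theorem exists_row_control (Q : Kernel E E) [IsFiniteKernel Q] {a : ℝ≥0}
    (h : essSpectralRadius (kernelOp Q) < a) (L : ℕ) :
    ∃ l, L ≤ l ∧ ∃ (t : Finset E) (C : ℝ≥0), ∀ x (A : Set E), MeasurableSet A →
      (Q ^ l) x A ≤ C * ∑ y ∈ t, (Q ^ l) y A + (a : ℝ≥0∞) ^ l := by
  let ev : E → bddMeas E →ₗ[ℂ] ℂ := fun x =>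
    { toFun := fun f => f.1 x
      map_add' := fun _ _ => rfl
      map_smul' := fun _ _ => rfl }
  obtain ⟨l, hl, t, C, hC⟩ := exists_sampling_control (kernelOp Q) h ev
    (fun x f => bddMeas_norm_le f x)
    (fun g hg => Subtype.ext (lp.ext (funext hg))) L
  refine ⟨l, hl, t, C, fun x A hA => ?_⟩
  have h1 := hC x (indicatorBdd A hA) (norm_indicatorBdd_le A hA)
  have hev : ∀ y, ev y ((kernelOp Q ^ l) (indicatorBdd A hA)) = (((Q ^ l) y).real A : ℂ) := by
    intro y
    rw [← kernelOp_pow]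
    exact kernelOp_indicatorBdd _ A hA y
  simp only [hev, Complex.norm_real, Real.norm_of_nonneg measureReal_nonneg] at h1
  have h2 := ENNReal.ofReal_le_ofReal h1
  rw [ENNReal.ofReal_add (by positivity) (by positivity), ENNReal.ofReal_mul (NNReal.coe_nonneg C),
    ENNReal.ofReal_sum_of_nonneg (fun _ _ => measureReal_nonneg)] at h2
  simpa [ofReal_measureReal, ENNReal.ofReal_pow] using h2

end KernelOperators

end QuasiCompact
namespace QuasiCompact

/-! ### Comparison of Δ and Λ -/

section SetFunctions

variable {E : Type*} [MeasurableSpace E]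

lemma deltaAt_le {ν : Measure E} {M : Set (FiniteMeasure E)} {c δ : ℝ≥0∞} (hδ : 0 < δ)
    (h : ∀ A, MeasurableSet A → ν A ≤ δ → ∀ μ ∈ M, (μ : Measure E) A ≤ c) : DeltaAt ν M ≤ c := by
  refine limsup_le_of_le (h := ?_)
  refine mem_of_superset (preimage_mem_comap (Iic_mem_nhds hδ)) fun A hA => ?_
  exact iSup₂_le fun μ hμ => h A.1 A.2 hA μ hμ

lemma exists_forall_le_of_deltaAt_lt {ν : Measure E} {M : Set (FiniteMeasure E)} {c : ℝ≥0∞}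
    (h : DeltaAt ν M < c) : ∃ δ : ℝ≥0, 0 < δ ∧
      ∀ A, MeasurableSet A → ν A ≤ δ → ∀ μ ∈ M, (μ : Measure E) A ≤ c := by
  have h1 := eventually_lt_of_limsup_lt h
  obtain ⟨δ, hδ, hsub⟩ := ((ENNReal.nhds_zero_basis_Iic.comap _).eventually_iff).1 h1
  obtain ⟨δ', h0, hδ'⟩ := ENNReal.lt_iff_exists_nnreal_btwn.1 hδ
  refine ⟨δ', by exact_mod_cast h0, fun A hA hν μ hμ => ?_⟩
  have := hsub (show (⟨A, hA⟩ : {A : Set E // MeasurableSet A}) ∈ _ from hν.trans hδ'.le)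
  exact (le_iSup₂ (f := fun (μ : FiniteMeasure E) (_ : μ ∈ M) => (μ : Measure E) A) μ hμ).trans
    this.le

lemma lam_le_deltaAt (ν : Measure E) [IsFiniteMeasure ν] (M : Set (FiniteMeasure E)) :
    Lam M ≤ DeltaAt ν M := by
  refine iSup₂_le fun A hA => iSup₂_le fun hanti hem => ?_
  have ht : Tendsto (fun n => ν (A n)) atTop (𝓝 0) := by
    have := tendsto_measure_iInter_atTop (μ := ν) (fun n => (hA n).nullMeasurableSet) hanti
      ⟨0, measure_ne_top _ _⟩
    rwa [hem, measure_empty] at this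
  have ht' : Tendsto (fun n => (⟨A n, hA n⟩ : {A : Set E // MeasurableSet A})) atTop
      (comap (fun A : {A : Set E // MeasurableSet A} => ν A.1) (𝓝 0)) := tendsto_comap_iff.2 ht
  have h1 : limsup (fun n => ⨆ μ ∈ M, (μ : Measure E) (A n)) atTop =
      limsup (fun A : {A : Set E // MeasurableSet A} => ⨆ μ ∈ M, (μ : Measure E) A.1)
        (map (fun n => (⟨A n, hA n⟩ : {A : Set E // MeasurableSet A})) atTop) := rfl
  rw [h1]
  exact limsup_le_limsup_of_le ht'

/-- If sets `A n` have mass at least `c` for some members of `M` for which `limsup A` is a null set,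
then `Λ(M) ≥ c`. -/
lemma le_lam_of_limsup_null {M : Set (FiniteMeasure E)} {c : ℝ≥0∞} {A : ℕ → Set E}
    (hA : ∀ n, MeasurableSet (A n)) {μ : ℕ → FiniteMeasure E} (hμ : ∀ n, μ n ∈ M)
    (hnull : ∀ n, (μ n : Measure E) (limsup A atTop) = 0)
    (hc : ∀ n, c ≤ (μ n : Measure E) (A n)) : c ≤ Lam M := by
  set N := limsup A atTop with hN
  have hNeq : N = ⋂ n, ⋃ i ≥ n, A i := by
    rw [hN, limsup_eq_iInf_iSup_of_nat]; simp
  set B : ℕ → Set E := fun n => ⋃ i ≥ n, A i with hB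
  have hBm : ∀ n, MeasurableSet (B n) := fun n =>
    .iUnion fun i => .iUnion fun _ => hA i
  have hNm : MeasurableSet N := hNeq ▸ .iInter hBm
  -- Removing N makes the tail unions decrease to the empty set and costs no μ n any mass.
  have hanti : Antitone fun n => B n \ N := fun m n hmn =>
    Set.sdiff_subset_sdiff_left (Set.biUnion_subset_biUnion_left fun i hi => le_trans hmn hi)
  have hem : ⋂ n, B n \ N = ∅ := by
    rw [Set.eq_empty_iff_forall_notMem]
    intro x hx
    rw [Set.mem_iInter] at hx
    exact (hx 0).2 (hNeq ▸ Set.mem_iInter.2 fun n => (hx n).1)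
  refine le_trans ?_ (le_iSup₂_of_le (fun n => B n \ N) (fun n => (hBm n).diff hNm)
    (le_iSup₂_of_le hanti hem le_rfl))
  refine le_trans ?_ (liminf_le_limsup)
  refine le_liminf_of_le (h := Eventually.of_forall fun n => ?_)
  refine le_trans ?_ (le_iSup₂ (f := fun (μ : FiniteMeasure E) (_ : μ ∈ M) =>
    (μ : Measure E) (B n \ N)) (μ n) (hμ n))
  rw [measure_sdiff_null (hnull n)]
  exact (hc n).trans (measure_mono (Set.subset_biUnion_of_mem (u := A) (le_refl n)))

lemma tsum_two_inv_pow_ne_top : ∑' n : ℕ, (2⁻¹ : ℝ≥0∞) ^ n ≠ ∞ := by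
  rw [ENNReal.tsum_geometric, ENNReal.one_sub_inv_two, inv_inv]
  exact ENNReal.ofNat_ne_top

/-- If sets of ν-measure at most 2⁻ⁿ keep mass above c', Borel–Cantelli makes their limit superior
ν-null, hence null for every member of M, and their tails witness Λ(M) ≥ c'. -/
lemma deltaAt_le_lam (ν : Measure E) (M : Set (FiniteMeasure E))
    (hM : ∀ μ ∈ M, (μ : Measure E) ≪ ν) : DeltaAt ν M ≤ Lam M := by
  refine le_of_forall_lt fun c hc => ?_
  obtain ⟨c', hcc', hc'⟩ := exists_between hc
  have hex : ∀ n : ℕ, ∃ A, MeasurableSet A ∧ ν A ≤ 2⁻¹ ^ n ∧ ∃ μ ∈ M, c' < (μ : Measure E) A := by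
    intro n
    by_contra! h
    exact hc'.not_ge (deltaAt_le (ENNReal.pow_pos (by simp) n) h)
  choose A hA hν μ hμ hμc using hex
  have hnull : ν (limsup A atTop) = 0 := measure_limsup_atTop_eq_zero
    (ne_top_of_le_ne_top tsum_two_inv_pow_ne_top (ENNReal.tsum_le_tsum hν))
  exact hcc'.trans_le (le_lam_of_limsup_null hA hμ (fun n => hM _ (hμ n) hnull)
    fun n => (hμc n).le)

lemma lam_singleton (κ : FiniteMeasure E) : Lam {κ} = 0 := by
  refine le_antisymm (iSup₂_le fun A hA => iSup₂_le fun hanti hem => ?_) zero_le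
  have := tendsto_measure_iInter_atTop (μ := (κ : Measure E))
    (fun n => (hA n).nullMeasurableSet) hanti ⟨0, measure_ne_top _ _⟩
  rw [hem, measure_empty] at this
  simp only [iSup_singleton]
  exact this.limsup_eq.le

/-- Absolute continuity of a finite measure in `ε`-`δ` form. -/
lemma exists_forall_measure_le_of_ac {ν : Measure E} {κ : FiniteMeasure E}
    (h : (κ : Measure E) ≪ ν) {ε : ℝ≥0∞} (hε : 0 < ε) :
    ∃ δ : ℝ≥0, 0 < δ ∧ ∀ A, MeasurableSet A → ν A ≤ δ → (κ : Measure E) A ≤ ε := by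
  have h1 : DeltaAt ν {κ} < ε := by
    refine lt_of_le_of_lt (deltaAt_le_lam ν {κ} ?_) (by rwa [lam_singleton])
    rintro _ rfl; exact h
  obtain ⟨δ, hδ, h2⟩ := exists_forall_le_of_deltaAt_lt h1
  exact ⟨δ, hδ, fun A hA hν => h2 A hA hν κ rfl⟩

lemma exists_forall_measure_le_of_ac_finset {ν : Measure E} (t : Finset (FiniteMeasure E))
    (h : ∀ κ ∈ t, (κ : Measure E) ≪ ν) {ε : ℝ≥0∞} (hε : 0 < ε) :
    ∃ δ : ℝ≥0, 0 < δ ∧ ∀ A, MeasurableSet A → ν A ≤ δ → ∀ κ ∈ t, (κ : Measure E) A ≤ ε := by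
  classical
  induction t using Finset.induction_on with
  | empty => exact ⟨1, one_pos, by simp⟩
  | insert κ t _ ih =>
    obtain ⟨δ₁, h1, h2⟩ := ih fun κ' hκ' => h κ' (Finset.mem_insert_of_mem hκ')
    obtain ⟨δ₂, h3, h4⟩ := exists_forall_measure_le_of_ac (h κ (Finset.mem_insert_self _ _)) hε
    refine ⟨min δ₁ δ₂, lt_min h1 h3, fun A hA hν κ' hκ' => ?_⟩
    rw [ENNReal.coe_min, le_min_iff] at hν
    rcases Finset.mem_insert.1 hκ' with rfl | h'
    · exact h4 A hA hν.2
    · exact h2 A hA hν.1 κ' h'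

/-- If `Λ(K) = 0`, the members of `K` are uniformly controlled by finitely many of them. -/
lemma exists_finset_control_of_lam_eq_zero {K : Set (FiniteMeasure E)} (hK : Lam K = 0)
    {ε : ℝ≥0∞} (hε : 0 < ε) :
    ∃ t : Finset (FiniteMeasure E), ∃ δ : ℝ≥0∞, 0 < δ ∧
      ∀ A, MeasurableSet A → (∀ κ ∈ t, (κ : Measure E) A ≤ δ) →
        ∀ μ ∈ K, (μ : Measure E) A ≤ ε := by
  classical
  by_contra! hcon
  -- If control fails, choose successively members of K with sets of mass above ε on which all
  -- earlier members have mass at most 2⁻ᵏ, k strictly increasing. Borel–Cantelli for each chosen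
  -- member contradicts Λ(K) = 0.
  obtain ⟨f, hf, hr⟩ := exists_seq_of_forall_finset_exists
    (fun y : FiniteMeasure E × Set E × ℕ =>
      y.1 ∈ K ∧ MeasurableSet y.2.1 ∧ ε < (y.1 : Measure E) y.2.1)
    (fun x y => (x.1 : Measure E) y.2.1 ≤ 2⁻¹ ^ y.2.2 ∧ x.2.2 < y.2.2) (by
      intro s _
      obtain ⟨A, hA, hsA, μ, hμ, hμA⟩ := hcon (s.image Prod.fst)
        (2⁻¹ ^ (s.sup (fun x => x.2.2) + 1)) (ENNReal.pow_pos (by simp) _)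
      exact ⟨⟨μ, A, s.sup (fun x => x.2.2) + 1⟩, ⟨hμ, hA, hμA⟩, fun x hx =>
        ⟨hsA _ (Finset.mem_image_of_mem _ hx),
          Nat.lt_succ_of_le (Finset.le_sup (f := fun x => x.2.2) hx)⟩⟩)
  have hk : ∀ n, n ≤ (f n).2.2 := fun n =>
    (strictMono_nat_of_lt_succ fun n => (hr n (n + 1) n.lt_succ_self).2).le_apply
  have hle : ε ≤ Lam K := by
    refine le_lam_of_limsup_null (A := fun n => (f n).2.1) (μ := fun n => (f n).1)
      (fun n => (hf n).2.1) (fun n => (hf n).1) (fun n => ?_) (fun n => (hf n).2.2.le)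
    rw [← limsup_nat_add _ (n + 1)]
    refine measure_limsup_atTop_eq_zero
      (ne_top_of_le_ne_top tsum_two_inv_pow_ne_top (ENNReal.tsum_le_tsum fun m => ?_))
    refine (hr n (m + (n + 1)) (by omega)).1.trans ?_
    exact pow_le_pow_right_of_le_one' (by simp) (le_trans (by omega) (hk (m + (n + 1))))
  rw [hK] at hle
  exact hε.not_ge hle

/-- The Dirac summand keeps the measure nonzero, so that it can be normalized. -/
lemma exists_isProbabilityMeasure_ac [Nonempty E] {ι : Type*} [Countable ι]
    (κ : ι → FiniteMeasure E) :
    ∃ ν : Measure E, IsProbabilityMeasure ν ∧ ∀ i, (κ i : Measure E) ≪ ν := by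
  let m : Measure E := Measure.sum (fun i => (κ i : Measure E)) +
    Measure.dirac (Classical.arbitrary E)
  have hm0 : NeZero m := ⟨fun h => by
    have := congrArg (fun μ : Measure E => μ Set.univ) h
    simp [m] at this⟩
  refine ⟨m.toFinite, inferInstance, fun i => ?_⟩
  refine Measure.AbsolutelyContinuous.trans ?_ (absolutelyContinuous_toFinite m)
  exact Measure.absolutelyContinuous_of_le
    ((Measure.le_sum (fun i => (κ i : Measure E)) i).trans (Measure.le_add_right le_rfl))

/-- For each n finitely many members control K up to 2⁻ⁿ; a ν dominating these countably many
measures works for all of K. -/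
theorem exists_deltaAt_eq_zero [Nonempty E] {K : Set (FiniteMeasure E)} (hK : Lam K = 0) :
    ∃ ν : Measure E, IsProbabilityMeasure ν ∧ DeltaAt ν K = 0 := by
  choose t δ hδ ht using fun n : ℕ =>
    exists_finset_control_of_lam_eq_zero hK (ENNReal.pow_pos (by simp : (0 : ℝ≥0∞) < 2⁻¹) n)
  obtain ⟨ν, hν, hac⟩ := exists_isProbabilityMeasure_ac fun i : Σ n, t n => i.2.1
  refine ⟨ν, hν, le_antisymm ?_ zero_le⟩
  have hn : ∀ n : ℕ, DeltaAt ν K ≤ 2⁻¹ ^ n := by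
    intro n
    obtain ⟨η, hη, h⟩ := exists_forall_measure_le_of_ac_finset (t n)
      (fun κ hκ => hac ⟨n, κ, hκ⟩) (hδ n)
    exact deltaAt_le (δ := η) (by exact_mod_cast hη) fun A hA hν => ht n A hA (h A hA hν)
  exact ge_of_tendsto' (ENNReal.tendsto_pow_atTop_nhds_zero_of_lt_one (by simp)) hn

end SetFunctions

end QuasiCompact
namespace QuasiCompact

/-! ### Weak sequential compactness and Γ = Δ -/

section WeakCompactness

/-- Bounded sequences in a separable Hilbert space have weakly convergent subsequences. -/
lemma exists_weakly_convergent_subseq {H : Type*} [NormedAddCommGroup H] [InnerProductSpace ℂ H]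
    [CompleteSpace H] [TopologicalSpace.SeparableSpace H] (u : ℕ → H) {r : ℝ}
    (hu : ∀ n, ‖u n‖ ≤ r) :
    ∃ (v : H) (k : ℕ → ℕ), StrictMono k ∧
      ∀ ψ : H →L[ℂ] ℂ, Tendsto (fun n => ψ (u (k n))) atTop (𝓝 (ψ v)) := by
  let D := InnerProductSpace.toDual ℂ H
  have hmem : ∀ n, StrongDual.toWeakDual (D (u n)) ∈
      WeakDual.toStrongDual ⁻¹' Metric.closedBall (0 : StrongDual ℂ H) r := by
    intro n
    change D (u n) ∈ Metric.closedBall (0 : StrongDual ℂ H) r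
    rw [mem_closedBall_zero_iff, LinearIsometryEquiv.norm_map]
    exact hu n
  obtain ⟨l, -, k, hk, hl⟩ := WeakDual.isSeqCompact_closedBall ℂ H 0 r hmem
  refine ⟨D.symm (WeakDual.toStrongDual l), k, hk, fun ψ => ?_⟩
  have h1 : Tendsto (fun n => D (u (k n)) (D.symm ψ)) atTop (𝓝 (l (D.symm ψ))) :=
    ((WeakDual.eval_continuous (D.symm ψ)).tendsto l).comp hl
  -- The Riesz isometry is conjugate linear, so the pairings must be conjugated to recover ψ.
  have h2 := (Complex.continuous_conj.tendsto _).comp h1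
  have h3 : ∀ w : H, (starRingEnd ℂ) (D w (D.symm ψ)) = ψ w := by
    intro w
    rw [InnerProductSpace.toDual_apply_apply, inner_conj_symm, InnerProductSpace.toDual_symm_apply]
  refine (h2.congr fun n => h3 _).trans_eq ?_
  congr 1
  rw [← h3, LinearIsometryEquiv.apply_symm_apply]
  rfl

variable {E : Type*} [MeasurableSpace E]

lemma toComplex_apply (μ : FiniteMeasure E) {A : Set E} (hA : MeasurableSet A) :
    toComplex μ A = ((μ : Measure E).real A : ℂ) := by
  rw [toComplex, SignedMeasure.toComplexMeasure_apply, Measure.toSignedMeasure_apply_measurable hA]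
  rfl

lemma enorm_apply_le_tvNorm (μ : ComplexMeasure E) (A : Set E) : ‖μ A‖ₑ ≤ tvNorm μ :=
  (VectorMeasure.enorm_measure_le_variation μ A).trans (measure_mono (Set.subset_univ A))

lemma tvNorm_sub_le {μ κ : FiniteMeasure E} {σ : Measure E} [IsFiniteMeasure σ]
    (h : (μ : Measure E) = κ + σ) : tvNorm (toComplex μ - toComplex κ) ≤ σ Set.univ := by
  refine VectorMeasure.variation_le_of_forall_enorm_le (fun A hA => ?_) Set.univ
  have h1 : (toComplex μ - toComplex κ) A = (σ.real A : ℂ) := by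
    rw [sub_apply, toComplex_apply μ hA, toComplex_apply κ hA, h, measureReal_add_apply]
    push_cast; ring
  rw [h1, ← ofReal_norm, Complex.norm_real, Real.norm_of_nonneg measureReal_nonneg,
    ofReal_measureReal]

/-- Evaluation at a set as a linear form on complex measures. -/
noncomputable def evalForm (A : Set E) : ComplexMeasure E →ₗ[ℂ] ℂ where
  toFun μ := μ A
  map_add' _ _ := rfl
  map_smul' _ _ := rfl

lemma isBoundedForm_evalForm (A : Set E) : IsBoundedForm (evalForm A) :=
  ⟨1, fun μ => by rw [ENNReal.coe_one, one_mul]; exact enorm_apply_le_tvNorm μ A⟩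

/-- Let μ n (A n) > ε with A n ↓ ∅. A weak limit l is countably additive, so ‖l (A m)‖ < ε for some
m, while monotonicity gives μ n (A m) > ε for n ≥ m. Evaluations at sets are the only forms needed.
-/
lemma lam_eq_zero_of_isWeaklySeqCompact {K : Set (FiniteMeasure E)}
    (hK : IsWeaklySeqCompact (toComplex '' K)) : Lam K = 0 := by
  refine le_antisymm (iSup₂_le fun A hA => iSup₂_le fun hanti hem => ?_) zero_le
  by_contra! hcon
  obtain ⟨ε, hε, hε'⟩ := ENNReal.lt_iff_exists_nnreal_btwn.1 hcon
  have hε0 : (0 : ℝ) < ε := by exact_mod_cast hε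
  have hfreq := frequently_lt_of_lt_limsup (h := hε')
  have hex : ∀ n, ∃ μ ∈ K, (ε : ℝ≥0∞) < (μ : Measure E) (A n) := by
    intro n
    obtain ⟨m, hm, hm'⟩ := (frequently_atTop.1 hfreq) n
    simp only [lt_iSup_iff] at hm'
    obtain ⟨μ, hμ, hμ'⟩ := hm'
    exact ⟨μ, hμ, hμ'.trans_le (measure_mono (hanti hm))⟩
  choose μ hμ hμε using hex
  obtain ⟨l, k, hk, hl⟩ := hK (fun n => toComplex (μ n)) fun n => ⟨μ n, hμ n, rfl⟩
  have h1 : Tendsto (fun m => ‖l (A m)‖) atTop (𝓝 0) := by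
    have := (VectorMeasure.tendsto_vectorMeasure_iInter_atTop_nat (v := l) hanti hA).norm
    rwa [hem, VectorMeasure.empty, norm_zero] at this
  obtain ⟨m, hm⟩ := (h1.eventually (gt_mem_nhds hε0)).exists
  have h2 := (hl (evalForm (A m)) (isBoundedForm_evalForm _)).norm
  obtain ⟨n, hn, hmn⟩ := ((h2.eventually (gt_mem_nhds hm)).and (eventually_ge_atTop m)).exists
  have h3 : evalForm (A m) (toComplex (μ (k n))) = ((μ (k n) : Measure E).real (A m) : ℂ) :=
    toComplex_apply _ (hA m)
  rw [h3, Complex.norm_real, Real.norm_of_nonneg measureReal_nonneg] at hn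
  have h4 := (hμε (k n)).trans_le (measure_mono (hanti (hmn.trans (hk.le_apply))))
  rw [← ofReal_measureReal, ← ENNReal.ofReal_coe_nnreal] at h4
  exact lt_asymm hn ((ENNReal.ofReal_lt_ofReal_iff_of_nonneg ε.2).1 h4)

/-- Choose ν with Δ_ν(K) = 0: on sets of small ν-measure a member of M has at most its distance to K
plus a small error. -/
theorem delta_le_gam [Nonempty E] (M : Set (FiniteMeasure E)) : Delta M ≤ Gam M := by
  refine le_iInf₂ fun K hK => ?_
  obtain ⟨ν, hν, hνK⟩ := exists_deltaAt_eq_zero (lam_eq_zero_of_isWeaklySeqCompact hK)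
  refine (iInf₂_le ν hν).trans ?_
  set d := ⨆ μ ∈ M, distTo μ K with hd
  refine ENNReal.le_of_forall_pos_le_add fun ε hε hdtop => ?_
  have hε2 : (0 : ℝ≥0∞) < (ε / 2 : ℝ≥0) := by exact_mod_cast half_pos hε
  obtain ⟨δ, hδ, h⟩ := exists_forall_le_of_deltaAt_lt (show DeltaAt ν K < (ε / 2 : ℝ≥0) by
    rwa [hνK])
  refine deltaAt_le (δ := δ) (by exact_mod_cast hδ) fun A hA hAδ μ hμ => ?_
  have h1 : distTo μ K < d + (ε / 2 : ℝ≥0) :=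
    (le_iSup₂ (f := fun (μ : FiniteMeasure E) (_ : μ ∈ M) => distTo μ K) μ hμ).trans_lt
      (ENNReal.lt_add_right hdtop.ne hε2.ne')
  simp only [distTo, iInf_lt_iff] at h1
  obtain ⟨κ, hκ, hκd⟩ := h1
  have h2 := (enorm_apply_le_tvNorm (toComplex μ - toComplex κ) A).trans hκd.le
  have h3 : (μ : Measure E) A = ‖toComplex μ A‖ₑ := by
    rw [toComplex_apply μ hA, ← ofReal_norm, Complex.norm_real,
      Real.norm_of_nonneg measureReal_nonneg, ofReal_measureReal]
  have h4 : (κ : Measure E) A = ‖toComplex κ A‖ₑ := by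
    rw [toComplex_apply κ hA, ← ofReal_norm, Complex.norm_real,
      Real.norm_of_nonneg measureReal_nonneg, ofReal_measureReal]
  have h5 : toComplex μ A = (toComplex μ - toComplex κ) A + toComplex κ A := by
    rw [sub_apply]; ring
  calc (μ : Measure E) A ≤ ‖(toComplex μ - toComplex κ) A‖ₑ + ‖toComplex κ A‖ₑ := by
        rw [h3, h5]; exact enorm_add_le _ _
    _ ≤ (d + (ε / 2 : ℝ≥0)) + (ε / 2 : ℝ≥0) := by
        rw [← h4]; exact add_le_add h2 (h A hA hAδ κ hκ)
    _ = d + ε := by rw [add_assoc, ← ENNReal.coe_add, add_halves]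

/-- The complex measure with a given square integrable density. -/
noncomputable def densityMap (ν : Measure E) [IsProbabilityMeasure ν] :
    Lp ℂ 2 ν →ₗ[ℂ] ComplexMeasure E where
  toFun G := ν.withDensityᵥ G
  map_add' G G' := by
    rw [← withDensityᵥ_add ((Lp.memLp G).integrable one_le_two)
      ((Lp.memLp G').integrable one_le_two)]
    exact WithDensityᵥEq.congr_ae (Lp.coeFn_add G G')
  map_smul' c G := by
    rw [RingHom.id_apply, ← withDensityᵥ_smul]
    exact WithDensityᵥEq.congr_ae (Lp.coeFn_smul c G)

/-- Variation is bounded by the L¹ norm, hence by the L² norm, so bounded forms on measures pull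
back to continuous forms on L². -/
lemma tvNorm_densityMap_le (ν : Measure E) [IsProbabilityMeasure ν] (G : Lp ℂ 2 ν) :
    tvNorm (densityMap ν G) ≤ ‖G‖ₑ := by
  have hint : Integrable G ν := (Lp.memLp G).integrable one_le_two
  have h1 : tvNorm (densityMap ν G) ≤ ν.withDensity (fun x => ‖G x‖ₑ) Set.univ := by
    refine VectorMeasure.variation_le_of_forall_enorm_le (fun A hA => ?_) Set.univ
    change ‖ν.withDensityᵥ G A‖ₑ ≤ _
    rw [withDensityᵥ_apply hint hA, withDensity_apply _ hA]
    exact enorm_integral_le_lintegral_enorm _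
  refine h1.trans ?_
  rw [withDensity_apply _ .univ, Measure.restrict_univ, ← eLpNorm_one_eq_lintegral_enorm,
    Lp.enorm_def]
  exact eLpNorm_le_eLpNorm_of_exponent_le one_le_two (Lp.aestronglyMeasurable G)

/-- The measures with a density with respect to `ν` that is bounded by `k`. -/
def boundedDensity (ν : Measure E) (k : ℝ≥0) : Set (FiniteMeasure E) :=
  {κ | ∃ g : E → ℝ≥0∞, Measurable g ∧ (∀ x, g x ≤ k) ∧ (κ : Measure E) = ν.withDensity g}

/-- The densities lie in a ball of L²(ν), separable because the σ-algebra is countably generated;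
`densityMap` transports weak convergence. -/
lemma isWeaklySeqCompact_boundedDensity [MeasurableSpace.CountablyGenerated E] (ν : Measure E)
    [IsProbabilityMeasure ν] (k : ℝ≥0) :
    IsWeaklySeqCompact (toComplex '' boundedDensity ν k) := by
  intro u hu
  choose κ hκ hκu using hu
  choose g hg hgk hκg using hκ
  have hbd : ∀ n x, ‖((g n x).toReal : ℂ)‖ ≤ k := fun n x => by
    rw [Complex.norm_real, Real.norm_of_nonneg ENNReal.toReal_nonneg]
    exact ENNReal.toReal_le_coe_of_le_coe (hgk n x)
  have hmem : ∀ n, MemLp (fun x => ((g n x).toReal : ℂ)) 2 ν := fun n =>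
    MemLp.of_bound
      (Complex.measurable_ofReal.comp (hg n).ennreal_toReal).aestronglyMeasurable k (Eventually.of_forall (hbd n))
  let G : ℕ → Lp ℂ 2 ν := fun n => (hmem n).toLp
  have hGn : ∀ n, ‖G n‖ ≤ k := fun n => by
    have := Lp.norm_le_of_ae_bound (f := G n) k.2
      ((hmem n).coeFn_toLp.mono fun x hx => by rw [hx]; exact hbd n x)
    simpa [measureUnivNNReal] using this
  have hJ : ∀ n, densityMap ν (G n) = u n := by
    intro n
    rw [← hκu n]
    have h1 : densityMap ν (G n) = ν.withDensityᵥ (fun x => ((g n x).toReal : ℂ)) :=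
      WithDensityᵥEq.congr_ae (hmem n).coeFn_toLp
    rw [h1]
    ext1 A hA
    rw [withDensityᵥ_apply ((hmem n).integrable one_le_two) hA, toComplex_apply _ hA, hκg n,
      integral_complex_ofReal, integral_toReal (hg n).aemeasurable
        (Eventually.of_forall fun x => (hgk n x).trans_lt ENNReal.coe_lt_top),
      measureReal_def, withDensity_apply _ hA]
  have : Fact ((2 : ℝ≥0∞) ≠ ∞) := ⟨ENNReal.ofNat_ne_top⟩
  obtain ⟨v, j, hj, hv⟩ := exists_weakly_convergent_subseq G hGn
  refine ⟨densityMap ν v, j, hj, fun φ hφ => ?_⟩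
  obtain ⟨C, hC⟩ := hφ
  let ψ : Lp ℂ 2 ν →L[ℂ] ℂ := LinearMap.mkContinuous (φ ∘ₗ densityMap ν) C fun G => by
    have h1 : ‖φ (densityMap ν G)‖ₑ ≤ C * ‖G‖ₑ :=
      (hC _).trans (mul_le_mul_right (tvNorm_densityMap_le ν G) _)
    rw [← ofReal_norm, ← ofReal_norm, ← ENNReal.ofReal_coe_nnreal,
      ← ENNReal.ofReal_mul (NNReal.coe_nonneg C)] at h1
    exact (ENNReal.ofReal_le_ofReal_iff (by positivity)).1 h1
  refine (hv ψ).congr fun n => ?_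
  rw [← hJ]; rfl

/-- S is {f > k} together with a ν-null carrier of ξ: it carries the whole excess, and Markov's
inequality bounds its ν-measure. -/
lemma exists_truncation_bound {ν μ ξ : Measure E} [IsFiniteMeasure μ] {f : E → ℝ≥0∞}
    (hf : Measurable f) (hμ : μ = ν.withDensity f + ξ) (hξ : ξ ⟂ₘ ν) (k : ℝ≥0∞) :
    μ = ν.withDensity (fun x => min (f x) k) + (ν.withDensity (fun x => f x - k) + ξ) ∧
    ∃ S, MeasurableSet S ∧ k * ν S ≤ μ Set.univ ∧
      (ν.withDensity (fun x => f x - k) + ξ) Set.univ ≤ μ S := by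
  refine ⟨?_, ?_⟩
  · rw [← add_assoc, ← withDensity_add_left (hf.min measurable_const), hμ]
    congr 2
    ext x
    simp only [Pi.add_apply]
    rcases le_total (f x) k with h | h
    · rw [min_eq_left h, tsub_eq_zero_of_le h, add_zero]
    · rw [min_eq_right h, add_tsub_cancel_of_le h]
  · obtain ⟨N, hN, hξN, hνN⟩ := hξ
    have hkm : MeasurableSet {x | k < f x} := measurableSet_lt measurable_const hf
    refine ⟨{x | k < f x} ∪ Nᶜ, hkm.union hN.compl, ?_, ?_⟩
    · calc k * ν ({x | k < f x} ∪ Nᶜ) ≤ k * ν {x | k ≤ f x} := by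
            refine mul_le_mul_right ((measure_union_le _ _).trans ?_) k
            rw [hνN, add_zero]
            exact measure_mono fun x hx => le_of_lt (show k < f x from hx)
        _ ≤ ∫⁻ x, f x ∂ν := mul_meas_ge_le_lintegral hf k
        _ ≤ μ Set.univ := by
            rw [hμ, Measure.add_apply, withDensity_apply _ .univ, Measure.restrict_univ]
            exact le_self_add
    · have h1 : ξ Set.univ ≤ ξ ({x | k < f x} ∪ Nᶜ) := by
        rw [← Set.union_compl_self N]
        refine (measure_union_le _ _).trans ?_
        rw [hξN, zero_add]
        exact measure_mono Set.subset_union_right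
      have h2 : ν.withDensity (fun x => f x - k) Set.univ ≤
          ν.withDensity f ({x | k < f x} ∪ Nᶜ) := by
        rw [withDensity_apply _ .univ, Measure.restrict_univ,
          withDensity_apply _ (hkm.union hN.compl),
          ← lintegral_indicator (hkm.union hN.compl)]
        refine lintegral_mono fun x => ?_
        by_cases hx : k < f x
        · rw [Set.indicator_of_mem (show x ∈ {x | k < f x} ∪ Nᶜ from Or.inl hx)]; exact tsub_le_self
        · rw [tsub_eq_zero_of_le (not_lt.1 hx)]; exact zero_le
      rw [hμ, Measure.add_apply, Measure.add_apply]
      exact add_le_add h2 h1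

/-- A truncation level at which the excess mass is uniformly small. -/
lemma exists_truncation_level {ν : Measure E} {M : Set (FiniteMeasure E)} {c : ℝ≥0∞} {B : ℝ≥0}
    (hB : ∀ μ ∈ M, (μ : Measure E) Set.univ ≤ B) (h : DeltaAt ν M < c) :
    ∃ k : ℝ≥0, ∀ μ ∈ M, ∀ S, MeasurableSet S → k * ν S ≤ (μ : Measure E) Set.univ →
      (μ : Measure E) S ≤ c := by
  obtain ⟨δ, hδ, hδM⟩ := exists_forall_le_of_deltaAt_lt h
  -- At this level mass at most B forces ν S ≤ δ; the 1 keeps the level nonzero when B = 0.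
  refine ⟨(B + 1) / δ, fun μ hμ S hS hk => hδM S hS ?_ μ hμ⟩
  have hk' := hk.trans ((hB μ hμ).trans (show (B : ℝ≥0∞) ≤ (B + 1 : ℝ≥0) by
    exact_mod_cast le_self_add))
  have hne : (((B + 1) / δ : ℝ≥0) : ℝ≥0∞) ≠ 0 := by
    exact_mod_cast (div_pos (by positivity) hδ).ne'
  rw [mul_comm, ← ENNReal.le_div_iff_mul_le (Or.inl hne) (Or.inl ENNReal.coe_ne_top)] at hk'
  refine hk'.trans (le_of_eq ?_)
  rw [← ENNReal.coe_div (div_pos (by positivity) hδ).ne', div_div_cancel₀ (by positivity)]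

theorem gam_le_delta [MeasurableSpace.CountablyGenerated E] {M : Set (FiniteMeasure E)} {B : ℝ≥0}
    (hB : ∀ μ ∈ M, (μ : Measure E) Set.univ ≤ B) : Gam M ≤ Delta M := by
  refine le_iInf₂ fun ν hν => ?_
  refine le_of_forall_gt fun c hc => ?_
  obtain ⟨c', hc', hcc'⟩ := exists_between hc
  obtain ⟨k, hk⟩ := exists_truncation_level hB hc'
  refine lt_of_le_of_lt (iInf₂_le_of_le (boundedDensity ν k)
    (isWeaklySeqCompact_boundedDensity ν k) (iSup₂_le fun μ hμ => ?_)) hcc'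
  obtain ⟨hdec, S, hS, hS1, hS2⟩ := exists_truncation_bound (ν := ν) (μ := μ)
    (f := (μ : Measure E).rnDeriv ν) (ξ := (μ : Measure E).singularPart ν)
    (Measure.measurable_rnDeriv _ _) (by rw [add_comm]; exact Measure.haveLebesgueDecomposition_add _ _)
    (Measure.mutuallySingular_singularPart _ _) k
  have hle := le_of_le_of_eq (Measure.le_add_right le_rfl) hdec.symm
  have hle' := le_of_le_of_eq (Measure.le_add_left le_rfl) hdec.symm
  have hfin1 : IsFiniteMeasure (ν.withDensity fun x => min ((μ : Measure E).rnDeriv ν x) k) :=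
    isFiniteMeasure_of_le _ hle
  have hfin2 := isFiniteMeasure_of_le _ hle'
  refine (iInf₂_le (⟨_, hfin1⟩ : FiniteMeasure E)
    ⟨_, (Measure.measurable_rnDeriv _ _).min measurable_const, fun x => min_le_right _ _, rfl⟩).trans ?_
  exact (tvNorm_sub_le hdec).trans (hS2.trans (hk μ hμ S hS hS1))

theorem gam_eq_delta [Nonempty E] [MeasurableSpace.CountablyGenerated E]
    {M : Set (FiniteMeasure E)} {B : ℝ≥0} (hB : ∀ μ ∈ M, (μ : Measure E) Set.univ ≤ B) :
    Gam M = Delta M :=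
  le_antisymm (gam_le_delta hB) (delta_le_gam M)

end WeakCompactness

end QuasiCompact
namespace QuasiCompact

/-! ### Powers of a perturbed operator -/

section PerturbationPowers

variable {X : Type*} [NormedAddCommGroup X] [NormedSpace ℂ X]

lemma isCompactOperator_of_subseq (S : X →L[ℂ] X)
    (h : ∀ f : ℕ → X, (∀ n, ‖f n‖ ≤ 1) → ∃ (y : X) (k : ℕ → ℕ), StrictMono k ∧
      Tendsto (fun n => S (f (k n))) atTop (𝓝 y)) : IsCompactOperator S := by
  refine (isCompactOperator_iff_isCompact_closure_image_closedBall (S : X →ₗ[ℂ] X) one_pos).2 ?_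
  refine IsSeqCompact.isCompact fun y hy => ?_
  have hex : ∀ n : ℕ, ∃ f : X, ‖f‖ ≤ 1 ∧ dist (y n) (S f) < 1 / ((n : ℝ) + 1) := by
    intro n
    obtain ⟨_, ⟨f, hf, rfl⟩, hd⟩ := Metric.mem_closure_iff.1 (hy n) (1 / ((n : ℝ) + 1))
      (by positivity)
    exact ⟨f, by simpa using hf, hd⟩
  choose f hf hd using hex
  obtain ⟨z, k, hk, hz⟩ := h f hf
  refine ⟨z, ?_, k, hk, ?_⟩
  · refine mem_closure_of_tendsto hz (Eventually.of_forall fun n => ⟨f (k n), ?_, rfl⟩)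
    simpa using hf (k n)
  · have h0 : Tendsto (fun n => dist (S (f (k n))) (y (k n))) atTop (𝓝 0) := by
      refine squeeze_zero (fun _ => dist_nonneg) (fun n => ?_)
        (tendsto_one_div_add_atTop_nhds_zero_nat.comp hk.tendsto_atTop)
      rw [dist_comm]; exact (hd (k n)).le
    exact (tendsto_iff_of_dist h0).1 hz

lemma exists_coverBound_add_pow (A B : X →L[ℂ] X)
    (hAB : ∀ i, IsCompactOperator (A * B ^ i * A : X →L[ℂ] X)) {c : ℝ} (hc : ‖B‖ < c) :
    ∃ n, ∃ β < c ^ n, CoverBound ((A + B) ^ n) β := by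
  obtain ⟨b, hBb, hbc⟩ := exists_between hc
  have hb : 0 < b := (norm_nonneg B).trans_lt hBb
  have hBn : ∀ n, ‖B ^ n‖ ≤ b ^ n := by
    intro n
    induction n with
    | zero => rw [pow_zero, pow_zero]; exact ContinuousLinearMap.norm_id_le
    | succ n ih =>
      rw [pow_succ, pow_succ]
      exact (norm_mul_le _ _).trans (mul_le_mul ih hBb.le (norm_nonneg _) (by positivity))
  -- W collects the words with at most one A. The last clause drives the induction: W - B^n consists
  -- of the words with exactly one A, so a further A on the left makes them compact.
  have hdec : ∀ n : ℕ, ∃ W K : X →L[ℂ] X, (A + B) ^ n = K + W ∧ IsCompactOperator K ∧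
      ‖W‖ ≤ b ^ n * (1 + n * (‖A‖ / b)) ∧
      ∀ i, IsCompactOperator (A * B ^ i * (W - B ^ n) : X →L[ℂ] X) := by
    intro n
    induction n with
    | zero =>
      refine ⟨1, 0, by simp, isCompactOperator_zero, ?_, fun i => ?_⟩
      · simp only [pow_zero, Nat.cast_zero, zero_mul, add_zero, mul_one]
        exact ContinuousLinearMap.norm_id_le
      · rw [pow_zero, sub_self, mul_zero]; exact isCompactOperator_zero
    | succ n ih =>
      obtain ⟨W, K, h1, hK, hW, hi⟩ := ih
      refine ⟨B * W + A * B ^ n, (A + B) * K + A * (W - B ^ n), ?_, ?_, ?_, fun i => ?_⟩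
      · rw [pow_succ', h1]; noncomm_ring
      · have h2 := hi 0
        rw [pow_zero, mul_one] at h2
        exact (hK.clm_comp (A + B)).add h2
      · calc ‖B * W + A * B ^ n‖ ≤ ‖B‖ * ‖W‖ + ‖A‖ * ‖B ^ n‖ :=
              (norm_add_le _ _).trans (add_le_add (norm_mul_le _ _) (norm_mul_le _ _))
          _ ≤ b * (b ^ n * (1 + n * (‖A‖ / b))) + ‖A‖ * b ^ n := by
              gcongr
              exact hBn n
          _ = _ := by push_cast; field_simp; ring
      · have h3 : A * B ^ i * (B * W + A * B ^ n - B ^ (n + 1)) =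
            A * B ^ (i + 1) * (W - B ^ n) + A * B ^ i * A * B ^ n := by
          rw [pow_succ B i, pow_succ' B n]; noncomm_ring
        rw [h3]
        exact (hi (i + 1)).add ((hAB i).comp_clm (B ^ n))
  have hq : |b / c| < 1 := by
    rw [abs_of_pos (div_pos hb (hb.trans hbc)), div_lt_one (hb.trans hbc)]; exact hbc
  have ht := (tendsto_pow_atTop_nhds_zero_of_abs_lt_one hq).add
    ((tendsto_pow_const_mul_const_pow_of_abs_lt_one 1 hq).mul_const (‖A‖ / b))
  rw [zero_mul, add_zero] at ht
  obtain ⟨n, hn⟩ := (ht.eventually (gt_mem_nhds one_pos)).exists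
  obtain ⟨W, K, h1, hK, hW, -⟩ := hdec n
  have hcn : 0 < c ^ n := pow_pos (hb.trans hbc) n
  have hlt : ‖W‖ < c ^ n := by
    refine hW.trans_lt ?_
    rw [div_pow, pow_one] at hn
    have h2 : b ^ n / c ^ n + n * (b ^ n / c ^ n) * (‖A‖ / b) =
        (b ^ n * (1 + n * (‖A‖ / b))) / c ^ n := by ring
    rwa [h2, div_lt_one hcn] at hn
  obtain ⟨β, hβ, hβ'⟩ := exists_between hlt
  exact ⟨n, β, hβ', h1 ▸ coverBound_add_of_isCompactOperator K W hK hβ⟩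

end PerturbationPowers

/-! ### Compactness for kernels with bounded density -/

section KernelCompactness

variable {E : Type*} [MeasurableSpace E]

set_option synthInstance.maxHeartbeats 200000

/-- Kernel operators are continuous for bounded pointwise convergence of sequences. -/
lemma tendsto_kernelOp_pow_apply (Q : Kernel E E) [IsFiniteKernel Q] {u : ℕ → bddMeas E}
    {f : bddMeas E} {C : ℝ} (hC : ∀ n, ‖u n‖ ≤ C)
    (hu : ∀ x, Tendsto (fun n => (u n).1 x) atTop (𝓝 (f.1 x))) (i : ℕ) (x : E) :
    Tendsto (fun n => ((kernelOp Q ^ i) (u n)).1 x) atTop (𝓝 (((kernelOp Q ^ i) f).1 x)) := by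
  rw [← kernelOp_pow]
  refine tendsto_integral_of_dominated_convergence (fun _ => C)
    (fun n => Measurable.aestronglyMeasurable (u n).2) (integrable_const C)
    (fun n => Eventually.of_forall fun y => (bddMeas_norm_le (u n) y).trans (hC n))
    (Eventually.of_forall hu)

/-- A kernel dominated by a multiple of a fixed finite measure turns bounded pointwise convergence
into norm convergence. -/
lemma tendsto_kernelOp_of_le (Q : Kernel E E) [IsFiniteKernel Q] {ν : Measure E}
    [IsFiniteMeasure ν] {k : ℝ≥0} (hQ : ∀ x, Q x ≤ k • ν) {u : ℕ → bddMeas E}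
    {f : bddMeas E} {C : ℝ} (hC : ∀ n, ‖u n‖ ≤ C)
    (hu : ∀ x, Tendsto (fun n => (u n).1 x) atTop (𝓝 (f.1 x))) :
    Tendsto (fun n => kernelOp Q (u n)) atTop (𝓝 (kernelOp Q f)) := by
  rw [tendsto_iff_norm_sub_tendsto_zero]
  have hlim : Tendsto (fun n => ∫ y, ‖(u n).1 y - f.1 y‖ ∂(k • ν)) atTop (𝓝 0) := by
    have := tendsto_integral_of_dominated_convergence (μ := k • ν)
      (F := fun n y => ‖(u n).1 y - f.1 y‖) (f := fun _ => 0) (fun _ => C + ‖f‖)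
      (fun n => (((u n - f : bddMeas E).2 : Measurable _).norm).aestronglyMeasurable)
      (integrable_const _)
      (fun n => Eventually.of_forall fun y => by
        rw [norm_norm]
        exact (norm_sub_le _ _).trans (add_le_add ((bddMeas_norm_le (u n) y).trans (hC n))
          (bddMeas_norm_le f y)))
      (Eventually.of_forall fun y => tendsto_iff_norm_sub_tendsto_zero.1 (hu y))
    simpa using this
  refine squeeze_zero (fun _ => norm_nonneg _) (fun n => ?_) hlim
  rw [← map_sub]
  refine bddMeas_norm_le_of_forall (integral_nonneg fun _ => norm_nonneg _) fun x => ?_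
  rw [kernelOp_apply]
  refine (norm_integral_le_integral_norm _).trans ?_
  exact integral_mono_measure (hQ x) (Eventually.of_forall fun _ => norm_nonneg _)
    (bddMeas_integrable (u n - f) (k • ν)).norm

/-- Q f(x) is the L²(ν) inner product of p x with f, so one weakly convergent subsequence serves
every x at once. -/
lemma exists_pointwise_convergent_subseq [MeasurableSpace.CountablyGenerated E] (Q : Kernel E E)
    [IsFiniteKernel Q] {ν : Measure E} [IsProbabilityMeasure ν] {k : ℝ≥0} {p : E → E → ℝ≥0∞}
    (hp : ∀ x, Measurable (p x)) (hpk : ∀ x y, p x y ≤ k) (hQ : ∀ x, Q x = ν.withDensity (p x))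
    (f : ℕ → bddMeas E) (hf : ∀ n, ‖f n‖ ≤ 1) :
    ∃ (h : bddMeas E) (j : ℕ → ℕ), StrictMono j ∧
      ∀ x, Tendsto (fun n => (kernelOp Q (f (j n))).1 x) atTop (𝓝 (h.1 x)) := by
  have hmem : ∀ n, MemLp (fun x => (f n).1 x) 2 ν := fun n =>
    MemLp.of_bound (Measurable.aestronglyMeasurable (f n).2) 1
      (Eventually.of_forall fun x => (bddMeas_norm_le (f n) x).trans (hf n))
  let G : ℕ → Lp ℂ 2 ν := fun n => (hmem n).toLp
  have hGn : ∀ n, ‖G n‖ ≤ 1 := fun n => by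
    have := Lp.norm_le_of_ae_bound (f := G n) zero_le_one
      ((hmem n).coeFn_toLp.mono fun x hx => by
        rw [hx]; exact (bddMeas_norm_le (f n) x).trans (hf n))
    simpa [measureUnivNNReal] using this
  have : Fact ((2 : ℝ≥0∞) ≠ ∞) := ⟨ENNReal.ofNat_ne_top⟩
  obtain ⟨v, j, hj, hv⟩ := exists_weakly_convergent_subseq G hGn
  have hpm : ∀ x, MemLp (fun y => ((p x y).toReal : ℂ)) 2 ν := fun x =>
    MemLp.of_bound (Complex.measurable_ofReal.comp (hp x).ennreal_toReal).aestronglyMeasurable k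
      (Eventually.of_forall fun y => by
        rw [Complex.norm_real, Real.norm_of_nonneg ENNReal.toReal_nonneg]
        exact ENNReal.toReal_le_coe_of_le_coe (hpk x y))
  let P : E → Lp ℂ 2 ν := fun x => (hpm x).toLp
  have hPG : ∀ x n, (kernelOp Q (f n)).1 x = innerSL ℂ (P x) (G n) := by
    intro x n
    rw [kernelOp_apply, hQ, integral_withDensity_eq_integral_toReal_smul (hp x)
      (Eventually.of_forall fun y => (hpk x y).trans_lt ENNReal.coe_lt_top), innerSL_apply_apply,
      L2.inner_def]
    refine integral_congr_ae ?_
    filter_upwards [(hpm x).coeFn_toLp, (hmem n).coeFn_toLp] with y h1 h2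
    change _ = inner ℂ (P x y) (G n y)
    rw [h1, h2]
    simp [mul_comm]
  have hlim : ∀ x, Tendsto (fun n => (kernelOp Q (f (j n))).1 x) atTop
      (𝓝 (innerSL ℂ (P x) v)) := fun x => by
    simp only [hPG]; exact hv (innerSL ℂ (P x))
  refine ⟨bddMeasOf (fun x => innerSL ℂ (P x) v) ?_ ‖kernelOp Q‖ fun x => ?_, j, hj, hlim⟩
  · exact measurable_of_tendsto_metrizable (fun n => (kernelOp Q (f (j n))).2)
      (tendsto_pi_nhds.2 hlim)
  · exact le_of_tendsto (hlim x).norm (Eventually.of_forall fun n =>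
      (bddMeas_norm_le _ x).trans ((kernelOp Q).unit_le_opNorm _ (hf (j n))))

/-- The right factor extracts a pointwise limit, the middle one preserves it by dominated
convergence, and the left one, dominated by k • ν, makes the convergence uniform. -/
lemma isCompactOperator_kernelOp_comp [MeasurableSpace.CountablyGenerated E]
    (Q R : Kernel E E) [IsFiniteKernel Q] [IsFiniteKernel R] {ν : Measure E}
    [IsProbabilityMeasure ν] {k : ℝ≥0} {p : E → E → ℝ≥0∞}
    (hp : ∀ x, Measurable (p x)) (hpk : ∀ x y, p x y ≤ k) (hQ : ∀ x, Q x = ν.withDensity (p x))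
    (i : ℕ) :
    IsCompactOperator (kernelOp Q * kernelOp R ^ i * kernelOp Q : bddMeas E →L[ℂ] bddMeas E) := by
  refine isCompactOperator_of_subseq _ fun f hf => ?_
  obtain ⟨h, j, hj, hlim⟩ := exists_pointwise_convergent_subseq Q hp hpk hQ f hf
  refine ⟨kernelOp Q ((kernelOp R ^ i) h), j, hj, ?_⟩
  have hle : ∀ x, Q x ≤ k • ν := fun x => by
    rw [hQ]
    refine (withDensity_mono (Eventually.of_forall (hpk x))).trans (le_of_eq ?_)
    rw [withDensity_const]; rfl
  have hb : ∀ n, ‖kernelOp Q (f (j n))‖ ≤ ‖kernelOp Q‖ := fun n =>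
    (kernelOp Q).unit_le_opNorm _ (hf (j n))
  refine tendsto_kernelOp_of_le Q hle (C := ‖kernelOp R ^ i‖ * ‖kernelOp Q‖) (fun n => ?_)
    fun x => tendsto_kernelOp_pow_apply R hb hlim i x
  exact ((kernelOp R ^ i).le_opNorm _).trans
    (mul_le_mul_of_nonneg_left (hb n) (ContinuousLinearMap.opNorm_nonneg _))

end KernelCompactness

end QuasiCompact
namespace QuasiCompact

/-! ### Upper and lower bounds for the essential spectral radius -/

section Bounds

variable {E : Type*} [MeasurableSpace E]

lemma rpow_one_div_le_iff {l : ℕ} (hl : 1 ≤ l) {x y : ℝ≥0∞} :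
    x ^ (1 / (l : ℝ)) ≤ y ↔ x ≤ y ^ l := by
  rw [one_div, ENNReal.rpow_inv_le_iff (by exact_mod_cast hl), ENNReal.rpow_natCast]

lemma le_rpow_one_div_iff {l : ℕ} (hl : 1 ≤ l) {x y : ℝ≥0∞} :
    y ≤ x ^ (1 / (l : ℝ)) ↔ y ^ l ≤ x := by
  rw [one_div, ENNReal.le_rpow_inv_iff (by exact_mod_cast hl), ENNReal.rpow_natCast]

lemma rows_mass_le (Q : Kernel E E) [IsFiniteKernel Q] :
    ∀ μ ∈ rows Q, (μ : Measure E) Set.univ ≤ (‖kernelOp Q‖₊ : ℝ≥0) := by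
  rintro _ ⟨x, rfl⟩
  exact measure_le_of_kernelOp_norm Q x

lemma mem_rows (Q : Kernel E E) [IsFiniteKernel Q] (x : E) :
    (⟨Q x, inferInstance⟩ : FiniteMeasure E) ∈ rows Q := ⟨x, rfl⟩

set_option synthInstance.maxHeartbeats 200000 in
theorem hasSplitting_of_delta_lt [MeasurableSpace.CountablyGenerated E] (Q : Kernel E E)
    [IsFiniteKernel Q] {l : ℕ} (hl : 1 ≤ l) {ρ : ℝ≥0}
    (h : Delta (rows (Q ^ l)) < (ρ : ℝ≥0∞) ^ l) : HasSplitting (kernelOp Q) ρ := by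
  have hρ : 0 < ρ := by
    rw [pos_iff_ne_zero]
    rintro rfl
    rw [ENNReal.coe_zero, zero_pow (by omega)] at h
    exact not_lt_zero h
  simp only [Delta, iInf_lt_iff] at h
  obtain ⟨ν, hν, h⟩ := h
  obtain ⟨c, hc, hcρ⟩ := ENNReal.lt_iff_exists_nnreal_btwn.1 h
  have hcρ' : (c : ℝ) < (ρ : ℝ) ^ l := by exact_mod_cast hcρ
  obtain ⟨k, hk⟩ := exists_truncation_level (rows_mass_le (Q ^ l)) hc
  set κ := Q ^ l with hκ
  let η : Kernel E E := Kernel.const E ν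
  -- The kernel version of the derivative is jointly measurable, so both truncated parts are again
  -- kernels.
  let f : E → E → ℝ≥0∞ := fun x y => κ.rnDeriv η x y
  have hf : Measurable (Function.uncurry f) := Kernel.measurable_rnDeriv κ η
  have hf1 : Measurable (Function.uncurry fun x y => min (f x y) k) := hf.min measurable_const
  have hf2 : Measurable (Function.uncurry fun x y => f x y - k) := hf.sub measurable_const
  let κ₁ : Kernel E E := Kernel.withDensity η fun x y => min (f x y) k
  let κ₂ : Kernel E E := (Kernel.withDensity η fun x y => f x y - k) + κ.singularPart η
  have hκ₁ : ∀ x, κ₁ x = ν.withDensity fun y => min (f x y) k := fun x =>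
    Kernel.withDensity_apply η hf1 x
  have hκ₂ : ∀ x, κ₂ x = (ν.withDensity fun y => f x y - k) + κ.singularPart η x := fun x => by
    change Kernel.withDensity η (fun x y => f x y - k) x + κ.singularPart η x = _
    rw [Kernel.withDensity_apply η hf2 x]; rfl
  have hdec : ∀ x, κ x = ν.withDensity (f x) + κ.singularPart η x := fun x => by
    conv_lhs => rw [← Kernel.rnDeriv_add_singularPart κ η]
    change Kernel.withDensity η (κ.rnDeriv η) x + κ.singularPart η x = _
    rw [Kernel.withDensity_apply η hf x]; rfl
  have htr := fun x => exists_truncation_bound (hf.of_uncurry_left (x := x)) (hdec x)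
    (Kernel.mutuallySingular_singularPart κ η x) k
  have hsum : ∀ x, κ x = κ₁ x + κ₂ x := fun x => by rw [hκ₁, hκ₂]; exact (htr x).1
  have hmass : ∀ x, κ₂ x Set.univ ≤ c := fun x => by
    obtain ⟨S, hS, hS1, hS2⟩ := (htr x).2
    rw [hκ₂]
    exact hS2.trans (hk _ (mem_rows κ x) S hS hS1)
  have hfin₁ : IsFiniteKernel κ₁ := isFiniteKernel_of_le (ν := κ) fun x => by
    rw [hsum]; exact Measure.le_add_right le_rfl
  have hfin₂ : IsFiniteKernel κ₂ := isFiniteKernel_of_le (ν := κ) fun x => by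
    rw [hsum]; exact Measure.le_add_left le_rfl
  have hop : kernelOp κ = kernelOp κ₁ + kernelOp κ₂ := by
    ext g x
    change ∫ y, g.1 y ∂(κ x) = ∫ y, g.1 y ∂(κ₁ x) + ∫ y, g.1 y ∂(κ₂ x)
    rw [hsum x, integral_add_measure (bddMeas_integrable g _) (bddMeas_integrable g _)]
  obtain ⟨n, β, hβ, hcov⟩ := exists_coverBound_add_pow (kernelOp κ₁) (kernelOp κ₂)
    (isCompactOperator_kernelOp_comp κ₁ κ₂ (k := k) (p := fun x y => min (f x y) k)
      (fun x => (hf1.of_uncurry_left (x := x))) (fun x y => min_le_right _ _) hκ₁)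
    ((norm_kernelOp_le κ₂ hmass).trans_lt hcρ')
  have hpow : kernelOp κ = kernelOp Q ^ l := kernelOp_pow Q l
  rw [← hop, hpow, ← pow_mul] at hcov
  rw [← pow_mul] at hβ
  exact hasSplitting_of_coverBound (kernelOp Q) hcov hβ hρ

theorem essSpectralRadius_le_delta [MeasurableSpace.CountablyGenerated E] (Q : Kernel E E)
    [IsFiniteKernel Q] {l : ℕ} (hl : 1 ≤ l) :
    essSpectralRadius (kernelOp Q) ≤ Delta (rows (Q ^ l)) ^ (1 / (l : ℝ)) := by
  refine le_of_forall_gt fun c hc => ?_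
  obtain ⟨ρ, hρ, hρc⟩ := ENNReal.lt_iff_exists_nnreal_btwn.1 hc
  refine lt_of_le_of_lt (inf_le_right.trans (iInf₂_le ρ (hasSplitting_of_delta_lt Q hl ?_))) hρc
  rw [← not_le] at hρ ⊢
  rwa [le_rpow_one_div_iff hl] at hρ

/-- The controlling rows are small on sets of small ν-measure, so only a^l survives. Allowing every
dominating ν covers both Δ and a prescribed Δ_ν. -/
theorem exists_deltaAt_rows_le (Q : Kernel E E) [IsFiniteKernel Q] {a : ℝ≥0}
    (h : essSpectralRadius (kernelOp Q) < a) (L : ℕ) :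
    ∃ l, L ≤ l ∧ ∃ t : Finset E, ∀ ν : Measure E, (∀ y ∈ t, (Q ^ l) y ≪ ν) →
      DeltaAt ν (rows (Q ^ l)) ≤ (a : ℝ≥0∞) ^ l := by
  classical
  obtain ⟨l, hl, t, C, hC⟩ := exists_row_control Q h L
  refine ⟨l, hl, t, fun ν hν => ?_⟩
  refine ENNReal.le_of_forall_pos_le_add fun ε hε _ => ?_
  have hD : 0 < C * t.card + 1 := by positivity
  obtain ⟨δ, hδ, hδt⟩ := exists_forall_measure_le_of_ac_finset
    (t.image fun y => (⟨(Q ^ l) y, inferInstance⟩ : FiniteMeasure E)) (ν := ν)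
    (by
      intro κ hκ
      obtain ⟨y, hy, rfl⟩ := Finset.mem_image.1 hκ
      exact hν y hy)
    (ε := (ε / (C * t.card + 1) : ℝ≥0)) (by exact_mod_cast div_pos hε hD)
  refine deltaAt_le (δ := δ) (by exact_mod_cast hδ) fun A hA hAδ μ hμ => ?_
  obtain ⟨x, rfl⟩ := hμ
  refine (hC x A hA).trans ?_
  rw [add_comm]
  refine add_le_add_right ?_ _
  calc C * ∑ y ∈ t, (Q ^ l) y A ≤ C * ∑ _y ∈ t, ((ε / (C * t.card + 1) : ℝ≥0) : ℝ≥0∞) := by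
        refine mul_le_mul_right (Finset.sum_le_sum fun y hy => ?_) _
        exact hδt A hA hAδ _ (Finset.mem_image_of_mem _ hy)
    _ = ((C * t.card * (ε / (C * t.card + 1)) : ℝ≥0) : ℝ≥0∞) := by
        rw [Finset.sum_const, nsmul_eq_mul]; push_cast; ring
    _ ≤ ε := by
        rw [ENNReal.coe_le_coe, ← mul_div_assoc, div_le_iff₀ hD, mul_comm ε]
        gcongr
        exact le_self_add

/-- An abstract d lets one argument serve Δ from L = 1 and Δ_ν from L = l₀. -/
lemma iInf_rpow_le_essSpectralRadius (Q : Kernel E E) [IsFiniteKernel Q] {d : ℕ → ℝ≥0∞} (L : ℕ)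
    (hL : 1 ≤ L) (hd : ∀ l, L ≤ l → ∀ (t : Finset E) (b : ℝ≥0∞),
      (∀ ν : Measure E, (∀ y ∈ t, (Q ^ l) y ≪ ν) → DeltaAt ν (rows (Q ^ l)) ≤ b) → d l ≤ b) :
    ⨅ (l : ℕ) (_ : L ≤ l), d l ^ (1 / (l : ℝ)) ≤ essSpectralRadius (kernelOp Q) := by
  refine le_of_forall_gt_imp_ge_of_dense fun c hc => ?_
  obtain ⟨a, ha, hac⟩ := ENNReal.lt_iff_exists_nnreal_btwn.1 hc
  obtain ⟨l, hl, t, ht⟩ := exists_deltaAt_rows_le Q ha L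
  refine (iInf₂_le l hl).trans (le_trans ?_ hac.le)
  exact (rpow_one_div_le_iff (hL.trans hl)).2 (hd l hl t _ ht)

lemma delta_le_of_finset [Nonempty E] (Q : Kernel E E) [IsFiniteKernel Q] (l : ℕ) (t : Finset E)
    (b : ℝ≥0∞)
    (h : ∀ ν : Measure E, (∀ y ∈ t, (Q ^ l) y ≪ ν) → DeltaAt ν (rows (Q ^ l)) ≤ b) :
    Delta (rows (Q ^ l)) ≤ b := by
  obtain ⟨ν, hν, hac⟩ := exists_isProbabilityMeasure_ac
    fun y : t => (⟨(Q ^ l) y, inferInstance⟩ : FiniteMeasure E)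
  exact (iInf₂_le ν hν).trans (h ν fun y hy => hac ⟨y, hy⟩)

theorem essSpectralRadius_eq_delta [Nonempty E] [MeasurableSpace.CountablyGenerated E]
    (Q : Kernel E E) [IsFiniteKernel Q] : essSpectralRadius (kernelOp Q) =
      ⨅ (l : ℕ) (_ : 1 ≤ l), Delta (rows (Q ^ l)) ^ (1 / (l : ℝ)) :=
  le_antisymm (le_iInf₂ fun _ hl => essSpectralRadius_le_delta Q hl)
    (iInf_rpow_le_essSpectralRadius Q 1 le_rfl fun l _ => delta_le_of_finset Q l)

theorem lamBar_le_essSpectralRadius [Nonempty E] [MeasurableSpace.CountablyGenerated E]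
    (Q : Kernel E E) [IsFiniteKernel Q] : LamBar Q ≤ essSpectralRadius (kernelOp Q) := by
  rw [essSpectralRadius_eq_delta]
  refine iInf₂_mono fun l _ => ENNReal.rpow_le_rpow ?_ (by positivity)
  exact le_iInf₂ fun ν _ => lam_le_deltaAt ν _

end Bounds

/-! ### Submultiplicativity of Λ -/

section Submultiplicativity

variable {E : Type*} [MeasurableSpace E]

lemma lam_le_of_forall_mass_le {M : Set (FiniteMeasure E)} {B : ℝ≥0∞}
    (hB : ∀ μ ∈ M, (μ : Measure E) Set.univ ≤ B) : Lam M ≤ B :=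
  iSup₂_le fun A _ => iSup₂_le fun _ _ => limsup_le_of_le (h := Eventually.of_forall fun n =>
    iSup₂_le fun μ hμ => (measure_mono (Set.subset_univ _)).trans (hB μ hμ))

lemma eventually_forall_measure_le_of_lam_lt {M : Set (FiniteMeasure E)} {c : ℝ≥0∞}
    (h : Lam M < c) {A : ℕ → Set E} (hA : ∀ n, MeasurableSet (A n)) (hanti : Antitone A)
    (hem : ⋂ n, A n = ∅) : ∀ᶠ n in atTop, ∀ μ ∈ M, (μ : Measure E) (A n) ≤ c := by
  have h1 : limsup (fun n => ⨆ μ ∈ M, (μ : Measure E) (A n)) atTop < c :=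
    lt_of_le_of_lt (by
      unfold Lam
      refine le_iSup₂_of_le A hA ?_
      rw [iSup_pos hanti, iSup_pos hem]) h
  filter_upwards [eventually_lt_of_limsup_lt h1] with n hn μ hμ
  exact (le_iSup₂ (f := fun (μ : FiniteMeasure E) (_ : μ ∈ M) => (μ : Measure E) (A n)) μ hμ).trans
    hn.le

/-- If A n ↓ ∅, the sets {y | ε < P y (A n)} also decrease to ∅. Off them the integrand is at most
ε; on them it is eventually at most Λ(P) + ε, and R gives them mass at most Λ(R) + ε. -/
theorem lam_rows_comp_le (P R S : Kernel E E) [IsFiniteKernel P] [IsFiniteKernel R]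
    [IsFiniteKernel S] (hS : S = P ∘ₖ R) : Lam (rows S) ≤ Lam (rows P) * Lam (rows R) := by
  have hPtop := ne_top_of_le_ne_top ENNReal.coe_ne_top (lam_le_of_forall_mass_le (rows_mass_le P))
  have hRtop := ne_top_of_le_ne_top ENNReal.coe_ne_top (lam_le_of_forall_mass_le (rows_mass_le R))
  obtain ⟨a, ha⟩ : ∃ a : ℝ≥0, (a : ℝ≥0∞) = Lam (rows P) := ⟨_, ENNReal.coe_toNNReal hPtop⟩
  obtain ⟨b, hb⟩ : ∃ b : ℝ≥0, (b : ℝ≥0∞) = Lam (rows R) := ⟨_, ENNReal.coe_toNNReal hRtop⟩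
  set B := ‖kernelOp R‖₊ with hB
  rw [← ha, ← hb]
  refine iSup₂_le fun A hA => iSup₂_le fun hanti hem => ?_
  have key : ∀ ε : ℝ≥0, 0 < ε → limsup (fun n => ⨆ μ ∈ rows S, (μ : Measure E) (A n)) atTop ≤
      ((ε * B + (a + ε) * (b + ε) : ℝ≥0) : ℝ≥0∞) := by
    intro ε hε
    have hε' : (ε : ℝ≥0∞) ≠ 0 := by exact_mod_cast hε.ne'
    have h1 := eventually_forall_measure_le_of_lam_lt (c := a + ε)
      (by rw [← ha]; exact ENNReal.lt_add_right ENNReal.coe_ne_top hε') hA hanti hem (M := rows P)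
    have h2 := eventually_forall_measure_le_of_lam_lt (M := rows R) (c := b + ε)
      (A := fun n => {y | (ε : ℝ≥0∞) < P y (A n)})
      (by rw [← hb]; exact ENNReal.lt_add_right ENNReal.coe_ne_top hε')
      (fun n => measurableSet_lt measurable_const (P.measurable_coe (hA n)))
      (fun m n hmn y hy => lt_of_lt_of_le (show (ε : ℝ≥0∞) < P y (A n) from hy)
        (measure_mono (hanti hmn)))
      (by
        rw [Set.eq_empty_iff_forall_notMem]
        intro y hy
        have ht := tendsto_measure_iInter_atTop (μ := P y) (fun n => (hA n).nullMeasurableSet)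
          hanti ⟨0, measure_ne_top _ _⟩
        rw [hem, measure_empty] at ht
        obtain ⟨n, hn⟩ := (ht.eventually (gt_mem_nhds (pos_iff_ne_zero.2 hε'))).exists
        exact lt_asymm hn (Set.mem_iInter.1 hy n))
    refine limsup_le_of_le (h := ?_)
    filter_upwards [h1, h2] with n h1 h2
    refine iSup₂_le fun μ hμ => ?_
    obtain ⟨x, rfl⟩ := hμ
    change S x (A n) ≤ _
    set D := {y | (ε : ℝ≥0∞) < P y (A n)} with hD
    have hDm : MeasurableSet D := measurableSet_lt measurable_const (P.measurable_coe (hA n))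
    rw [hS, Kernel.comp_apply' _ _ _ (hA n)]
    calc ∫⁻ y, P y (A n) ∂(R x)
        ≤ ∫⁻ y, (ε + D.indicator (fun _ => (a + ε : ℝ≥0∞)) y) ∂(R x) := by
          refine lintegral_mono fun y => ?_
          by_cases hy : y ∈ D
          · rw [Set.indicator_of_mem hy]
            exact (h1 _ (mem_rows P y)).trans le_add_self
          · rw [Set.indicator_of_notMem hy, add_zero]
            exact not_lt.1 hy
      _ = ε * R x Set.univ + (a + ε) * R x D := by
          rw [lintegral_add_left measurable_const, lintegral_const,
            lintegral_indicator_const hDm]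
      _ ≤ ε * B + (a + ε) * (b + ε) := by
          gcongr
          · exact measure_le_of_kernelOp_norm R x
          · exact h2 _ (mem_rows R x)
      _ = _ := by push_cast; rfl
  have hcont : Tendsto (fun ε : ℝ≥0 => ((ε * B + (a + ε) * (b + ε) : ℝ≥0) : ℝ≥0∞)) (𝓝[>] 0)
      (𝓝 ((0 * B + (a + 0) * (b + 0) : ℝ≥0) : ℝ≥0∞)) := by
    refine (ENNReal.tendsto_coe.2 ?_).mono_left nhdsWithin_le_nhds
    exact (by fun_prop : Continuous fun ε : ℝ≥0 => ε * B + (a + ε) * (b + ε)).tendsto 0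
  have := ge_of_tendsto hcont (eventually_mem_nhdsWithin.mono fun ε hε => key ε hε)
  simpa using this

theorem lam_rows_pow_mul_le (Q : Kernel E E) [IsFiniteKernel Q] (l j : ℕ) :
    Lam (rows (Q ^ (l * (j + 1)))) ≤ Lam (rows (Q ^ l)) ^ (j + 1) := by
  induction j with
  | zero => rw [zero_add, pow_one, mul_one]
  | succ j ih =>
    refine (lam_rows_comp_le (Q ^ (l * (j + 1))) (Q ^ l) (Q ^ (l * (j + 1 + 1))) ?_).trans ?_
    · rw [mul_add, mul_one, pow_add]; rfl
    · rw [pow_succ]; exact mul_le_mul_left ih _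

end Submultiplicativity

/-! ### Kernels with densities -/

section Density

variable {E : Type*} [MeasurableSpace E]

/-- By Markov {q ≥ k} has uniformly small ν-measure for large k, so tails are bounded through Δ_ν;
conversely the mass of A is at most a tail plus k ν(A). -/
theorem deltaAt_rows_rpow_eq (κ : Kernel E E) [IsFiniteKernel κ] {ν : Measure E}
    [IsProbabilityMeasure ν] {q : E × E → ℝ≥0∞} (hq : Measurable q)
    (hκ : ∀ x, κ x = ν.withDensity fun y => q (x, y)) {l : ℕ} (hl : 1 ≤ l) :
    DeltaAt ν (rows κ) ^ (1 / (l : ℝ)) = ⨅ k : ℝ≥0, ⨆ x : E,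
      (∫⁻ y in {y | (k : ℝ≥0∞) ≤ q (x, y)}, q (x, y) ∂ν) ^ (1 / (l : ℝ)) := by
  have hqx : ∀ x, Measurable fun y => q (x, y) := fun x => hq.comp measurable_prodMk_left
  have hm : ∀ (k : ℝ≥0) x, MeasurableSet {y | (k : ℝ≥0∞) ≤ q (x, y)} := fun k x =>
    measurableSet_le measurable_const (hqx x)
  apply le_antisymm
  · refine le_iInf fun k => ?_
    rw [rpow_one_div_le_iff hl]
    set F := ⨆ x : E, (∫⁻ y in {y | (k : ℝ≥0∞) ≤ q (x, y)}, q (x, y) ∂ν) ^ (1 / (l : ℝ)) with hF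
    refine ENNReal.le_of_forall_pos_le_add fun ε hε _ => ?_
    refine deltaAt_le (δ := (ε / (k + 1) : ℝ≥0)) (by exact_mod_cast div_pos hε (by positivity))
      fun A hA hAδ μ hμ => ?_
    obtain ⟨x, rfl⟩ := hμ
    change κ x A ≤ _
    have h1 : ∫⁻ y in {y | (k : ℝ≥0∞) ≤ q (x, y)}, q (x, y) ∂ν ≤ F ^ l := by
      rw [← rpow_one_div_le_iff hl]
      exact le_iSup (fun x : E =>
        (∫⁻ y in {y | (k : ℝ≥0∞) ≤ q (x, y)}, q (x, y) ∂ν) ^ (1 / (l : ℝ))) x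
    have h2 : k * ν A ≤ ε := by
      calc k * ν A ≤ k * (ε / (k + 1) : ℝ≥0) := mul_le_mul_right hAδ _
        _ = ((k * (ε / (k + 1)) : ℝ≥0) : ℝ≥0∞) := by push_cast; rfl
        _ ≤ ε := by
            rw [ENNReal.coe_le_coe, ← mul_div_assoc, div_le_iff₀ (by positivity), mul_comm ε]
            gcongr
            exact le_self_add
    rw [hκ, withDensity_apply _ hA]
    calc ∫⁻ y in A, q (x, y) ∂ν
        ≤ ∫⁻ y in A, ({y | (k : ℝ≥0∞) ≤ q (x, y)}.indicator (fun y => q (x, y)) y + k) ∂ν := by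
          refine lintegral_mono fun y => ?_
          by_cases hy : (k : ℝ≥0∞) ≤ q (x, y)
          · rw [Set.indicator_of_mem (show y ∈ {y | (k : ℝ≥0∞) ≤ q (x, y)} from hy)]
            exact le_self_add
          · exact (not_le.1 hy).le.trans le_add_self
      _ ≤ F ^ l + k * ν A := by
          rw [lintegral_add_right _ measurable_const, setLIntegral_const]
          refine add_le_add_left ((setLIntegral_le_lintegral _ _).trans ?_) _
          rw [lintegral_indicator (hm k x)]
          exact h1
      _ ≤ F ^ l + ε := add_le_add_right h2 _
  · rw [le_rpow_one_div_iff hl]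
    refine le_of_forall_gt_imp_ge_of_dense fun c hc => ?_
    obtain ⟨k, hk⟩ := exists_truncation_level (rows_mass_le κ) hc
    rw [← le_rpow_one_div_iff hl]
    refine (iInf_le _ k).trans (iSup_le fun x => ENNReal.rpow_le_rpow ?_ (by positivity))
    have h1 := hk _ (mem_rows κ x) _ (hm k x) (by
      change k * ν _ ≤ κ x Set.univ
      rw [hκ, withDensity_apply _ .univ, Measure.restrict_univ]
      exact mul_meas_ge_le_lintegral (hqx x) k)
    change κ x _ ≤ c at h1
    rwa [hκ, withDensity_apply _ (hm k x)] at h1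

/-- Monotonicity in k makes the limit exist and equal the infimum. -/
lemma antitone_iSup_tail {ν : Measure E} (q : E × E → ℝ≥0∞) (l : ℕ) :
    Antitone fun k : ℝ≥0 => ⨆ x : E,
      (∫⁻ y in {y | (k : ℝ≥0∞) ≤ q (x, y)}, q (x, y) ∂ν) ^ (1 / (l : ℝ)) := by
  intro k k' hk
  refine iSup_mono fun x => ENNReal.rpow_le_rpow (lintegral_mono_set fun y hy => ?_)
    (by positivity)
  exact le_trans (ENNReal.coe_le_coe.2 hk) hy

theorem essSpectralRadius_eq_gam [Nonempty E] [MeasurableSpace.CountablyGenerated E]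
    (Q : Kernel E E) [IsFiniteKernel Q] : essSpectralRadius (kernelOp Q) =
      ⨅ (l : ℕ) (_ : 1 ≤ l), Gam (rows (Q ^ l)) ^ (1 / (l : ℝ)) := by
  rw [essSpectralRadius_eq_delta Q]
  exact iInf_congr fun l => iInf_congr fun _ => by rw [gam_eq_delta (rows_mass_le (Q ^ l))]

section AbsolutelyContinuous

variable [MeasurableSpace.CountablyGenerated E] (Q : Kernel E E) [IsFiniteKernel Q]
  {ν : Measure E} [IsProbabilityMeasure ν] {l₀ : ℕ}

lemma essSpectralRadius_le_deltaAt (ν : Measure E) [IsProbabilityMeasure ν] {l : ℕ} (hl : 1 ≤ l) :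
    essSpectralRadius (kernelOp Q) ≤ DeltaAt ν (rows (Q ^ l)) ^ (1 / (l : ℝ)) :=
  (essSpectralRadius_le_delta Q hl).trans
    (ENNReal.rpow_le_rpow (iInf₂_le ν ‹IsProbabilityMeasure ν›) (by positivity))

lemma essSpectralRadius_eq_deltaAt (hl₀ : 1 ≤ l₀) (hac : ∀ l, l₀ ≤ l → ∀ x, (Q ^ l) x ≪ ν) :
    essSpectralRadius (kernelOp Q) =
      ⨅ (l : ℕ) (_ : l₀ ≤ l), DeltaAt ν (rows (Q ^ l)) ^ (1 / (l : ℝ)) :=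
  le_antisymm (le_iInf₂ fun _ hl => essSpectralRadius_le_deltaAt Q ν (hl₀.trans hl))
    (iInf_rpow_le_essSpectralRadius Q l₀ hl₀ fun _ hl _ _ hb => hb ν fun y _ => hac _ hl y)

/-- Absolute continuity is known only from l₀ on: pass from l to l * l₀, where Δ_ν ≤ Λ, and return
by submultiplicativity. -/
lemma essSpectralRadius_le_lamBar (hl₀ : 1 ≤ l₀) (hac : ∀ l, l₀ ≤ l → ∀ x, (Q ^ l) x ≪ ν) :
    essSpectralRadius (kernelOp Q) ≤ LamBar Q := by
  refine le_iInf₂ fun l hl => ?_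
  obtain ⟨j, rfl⟩ : ∃ j, l₀ = j + 1 := ⟨l₀ - 1, by omega⟩
  have hn : j + 1 ≤ l * (j + 1) := Nat.le_mul_of_pos_left _ hl
  refine (essSpectralRadius_le_deltaAt Q ν (hl₀.trans hn)).trans ?_
  have h1 : DeltaAt ν (rows (Q ^ (l * (j + 1)))) ≤ Lam (rows (Q ^ l)) ^ (j + 1) := by
    refine (deltaAt_le_lam ν _ ?_).trans (lam_rows_pow_mul_le Q l j)
    rintro _ ⟨x, rfl⟩
    exact hac _ hn x
  rw [rpow_one_div_le_iff (hl₀.trans hn), pow_mul (Lam (rows (Q ^ l)) ^ (1 / (l : ℝ)))]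
  refine h1.trans (pow_le_pow_left₀ zero_le ?_ _)
  rw [← rpow_one_div_le_iff hl]

end AbsolutelyContinuous

end Density

end QuasiCompact

theorem mainTheorem8 {E : Type*} [MeasurableSpace E] [Nonempty E]
    [MeasurableSpace.CountablyGenerated E] (Q : Kernel E E) [IsFiniteKernel Q] :
    QuasiCompact.essSpectralRadius (QuasiCompact.kernelOp Q) =
        ⨅ (l : ℕ) (_ : 1 ≤ l),
          QuasiCompact.Delta (QuasiCompact.rows (Q ^ l)) ^ (1 / (l : ℝ)) ∧
    QuasiCompact.essSpectralRadius (QuasiCompact.kernelOp Q) =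
        ⨅ (l : ℕ) (_ : 1 ≤ l),
          QuasiCompact.Gam (QuasiCompact.rows (Q ^ l)) ^ (1 / (l : ℝ)) ∧
    QuasiCompact.LamBar Q ≤ QuasiCompact.essSpectralRadius (QuasiCompact.kernelOp Q) ∧
    ∀ (ν : Measure E) [IsProbabilityMeasure ν] (l₀ : ℕ) (q : ℕ → E × E → ℝ≥0∞),
      1 ≤ l₀ →
      (∀ l, l₀ ≤ l → Measurable (q l)) →
      (∀ l, l₀ ≤ l → ∀ x : E, (Q ^ l) x = ν.withDensity (fun y => q l (x, y))) →
      QuasiCompact.essSpectralRadius (QuasiCompact.kernelOp Q) =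
          ⨅ (l : ℕ) (_ : 1 ≤ l),
            QuasiCompact.DeltaAt ν (QuasiCompact.rows (Q ^ l)) ^ (1 / (l : ℝ)) ∧
      QuasiCompact.essSpectralRadius (QuasiCompact.kernelOp Q) = QuasiCompact.LamBar Q ∧
      ∃ D : ℕ → ℝ≥0∞,
        (∀ l, l₀ ≤ l →
          Tendsto
            (fun k : ℝ≥0 => ⨆ x : E,
              (∫⁻ y in {y | (k : ℝ≥0∞) ≤ q l (x, y)}, q l (x, y) ∂ν) ^ (1 / (l : ℝ)))
            atTop (𝓝 (D l))) ∧
        QuasiCompact.essSpectralRadius (QuasiCompact.kernelOp Q) =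
          ⨅ (l : ℕ) (_ : l₀ ≤ l), D l := by
  refine ⟨QuasiCompact.essSpectralRadius_eq_delta Q, QuasiCompact.essSpectralRadius_eq_gam Q,
    QuasiCompact.lamBar_le_essSpectralRadius Q, ?_⟩
  intro ν _ l₀ q hl₀ hq hQ
  have hac : ∀ l, l₀ ≤ l → ∀ x, (Q ^ l) x ≪ ν := fun l hl x => by
    rw [hQ l hl x]; exact withDensity_absolutelyContinuous _ _
  have heq := QuasiCompact.essSpectralRadius_eq_deltaAt Q hl₀ hac
  refine ⟨le_antisymm
      (le_iInf₂ fun l hl => QuasiCompact.essSpectralRadius_le_deltaAt Q ν hl) ?_,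
    le_antisymm (QuasiCompact.essSpectralRadius_le_lamBar Q hl₀ hac)
      (QuasiCompact.lamBar_le_essSpectralRadius Q),
    fun l => ⨅ k : ℝ≥0, ⨆ x : E,
      (∫⁻ y in {y | (k : ℝ≥0∞) ≤ q l (x, y)}, q l (x, y) ∂ν) ^ (1 / (l : ℝ)),
    fun l _ => tendsto_atTop_iInf (QuasiCompact.antitone_iSup_tail (q l) l), ?_⟩
  -- The infimum over 1 ≤ l is at most the one over l₀ ≤ l.
  · rw [heq]
    exact le_iInf₂ fun l hl => iInf₂_le l (hl₀.trans hl)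
  · rw [heq]
    exact iInf_congr fun l => iInf_congr fun hl =>
      QuasiCompact.deltaAt_rows_rpow_eq (Q ^ l) (hq l hl) (hQ l hl) (hl₀.trans hl)
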